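/- Let $N\ge 1$, let $\Omega\subset\mathbb{R}^N$ be a bounded open set, let $1\le k\le N$, and let $P,Q\subset\{1,\dots,N\}$ be sets of cardinality $k$. For $u$ in a Sobolev space $W^{2,p}(\Omega)$ with $p\ge k$, let $$\mathfrak{M}_k(D^2u)=\det\left[\left(\frac{\partial^2 u}{\partial x_p\,\partial x_q}\right)_{p\in P,\;q\in Q}\right]$$ be the corresponding minor of order $k$ of the Hessian matrix $D^2u$ of weak second derivatives. Let $\mathcal{M}(\Omega)$ be the space of signed Radon measures on $\Omega$ with finite mass, i.e. the dual of the space $C_0(\Omega)$ of continuous functions on $\Omega$ vanishing at infinity (that is, at $\partial\Omega$), and identify $f\in L^1(\Omega)$ with the measure $f\,dx$. (1) If $u_n\rightharpoonup u$ weakly in $W^{2,k}(\Omega)$, then $\mathfrak{M}_k(D^2u_n)$ and $\mathfrak{M}_k(D^2u)$ belong to $L^1(\Omega)$ and $$\mathfrak{M}_k(D^2u_n)\overset{*}{\rightharpoonup}\mathfrak{M}_k(D^2u)\qquad\text{weakly-}*\text{ in }\mathcal{M}(\Omega).$$ (2) If $1<\wp<\infty$ and $u_n\rightharpoonup u$ weakly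 in $W^{2,k\wp}(\Omega)$, then $\mathfrak{M}_k(D^2u_n)$ and $\mathfrak{M}_k(D^2u)$ belong to $L^\wp(\Omega)$ and $$\mathfrak{M}_k(D^2u_n)\rightharpoonup\mathfrak{M}_k(D^2u)\qquad\text{weakly in }L^{\wp}(\Omega).$$ -/

import Mathlib

open MeasureTheory Filter Topology TopologicalSpace
open scoped ENNReal ZeroAtInfty Distributions

noncomputable section

namespace HessianMinors

/-- The space `ℝ^N` with its Euclidean norm. -/
abbrev Eucl (N : ℕ) : Type := EuclideanSpace ℝ (Fin N)

/-- Lebesgue measure on the open set `Ω`. -/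
abbrev lebesgueOn {N : ℕ} (Ω : Opens (Eucl N)) : Measure (Eucl N) :=
  (volume : Measure (Eucl N)).restrict (Ω : Set (Eucl N))

/-- The classical partial derivative `∂φ/∂x_i`. -/
def partialDeriv {N : ℕ} (φ : Eucl N → ℝ) (i : Fin N) (x : Eucl N) : ℝ :=
  fderiv ℝ φ x (EuclideanSpace.single i 1)

/-- `g` is the weak derivative of `f` in `Ω` in the direction `x_i`: for every `φ ∈ C_c^∞(Ω)`,
`∫_Ω f ∂φ/∂x_i dx = - ∫_Ω g φ dx`. It is applied only to `f`, `g` in `L^p(Ω)`, `p ≥ 1`, for which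
both integrands are integrable. -/
def HasWeakPartialDeriv {N : ℕ} (Ω : Opens (Eucl N)) (i : Fin N) (f g : Eucl N → ℝ) : Prop :=
  ∀ φ : TestFunction Ω ℝ (⊤ : ℕ∞),
    ∫ x, f x * partialDeriv φ i x ∂(lebesgueOn Ω) = - ∫ x, g x * φ x ∂(lebesgueOn Ω)

/-- `L^p(Ω)`. -/
abbrev LpOn {N : ℕ} (Ω : Opens (Eucl N)) (p : ℝ≥0∞) : Type :=
  Lp ℝ p (lebesgueOn Ω)

theorem integrable_mul_of_hasCompactSupport {N : ℕ} {Ω : Opens (Eucl N)} {p : ℝ≥0∞}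
    [hp : Fact (1 ≤ p)] (f : LpOn Ω p) {ψ : Eucl N → ℝ} (hc : Continuous ψ)
    (hs : HasCompactSupport ψ) :
    Integrable (fun x => f x * ψ x) (lebesgueOn Ω) := by
  have hf : LocallyIntegrable (f : Eucl N → ℝ) (lebesgueOn Ω) :=
    (Lp.memLp f).locallyIntegrable hp.out
  simpa [mul_comm] using hf.integrable_smul_left_of_hasCompactSupport hc hs

theorem continuous_partialDeriv {N : ℕ} {Ω : Opens (Eucl N)}
    (φ : TestFunction Ω ℝ (⊤ : ℕ∞)) (i : Fin N) : Continuous (partialDeriv φ i) :=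
  ((TestFunctionClass.map_contDiff φ).continuous_fderiv (by simp)).clm_apply continuous_const

theorem hasCompactSupport_partialDeriv {N : ℕ} {Ω : Opens (Eucl N)}
    (φ : TestFunction Ω ℝ (⊤ : ℕ∞)) (i : Fin N) : HasCompactSupport (partialDeriv φ i) :=
  (TestFunctionClass.map_hasCompactSupport φ).fderiv_apply (𝕜 := ℝ) _

theorem HasWeakPartialDeriv.congr {N : ℕ} {Ω : Opens (Eucl N)} {i : Fin N}
    {f g f' g' : Eucl N → ℝ} (h : HasWeakPartialDeriv Ω i f g)
    (hf : f' =ᵐ[lebesgueOn Ω] f) (hg : g' =ᵐ[lebesgueOn Ω] g) :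
    HasWeakPartialDeriv Ω i f' g' := by
  intro φ
  have h1 : ∫ x, f' x * partialDeriv φ i x ∂(lebesgueOn Ω) =
      ∫ x, f x * partialDeriv φ i x ∂(lebesgueOn Ω) :=
    integral_congr_ae (hf.mul (ae_eq_refl (partialDeriv φ i)))
  have h2 : ∫ x, g' x * φ x ∂(lebesgueOn Ω) = ∫ x, g x * φ x ∂(lebesgueOn Ω) :=
    integral_congr_ae (hg.mul (ae_eq_refl (φ : Eucl N → ℝ)))
  rw [h1, h2]
  exact h φ

theorem HasWeakPartialDeriv.zero {N : ℕ} (Ω : Opens (Eucl N)) (p : ℝ≥0∞) (i : Fin N) :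
    HasWeakPartialDeriv Ω i (0 : LpOn Ω p) (0 : LpOn Ω p) := by
  have h : HasWeakPartialDeriv Ω i (0 : Eucl N → ℝ) (0 : Eucl N → ℝ) := by intro φ; simp
  exact h.congr (Lp.coeFn_zero _ _ _) (Lp.coeFn_zero _ _ _)

theorem HasWeakPartialDeriv.add {N : ℕ} {Ω : Opens (Eucl N)} {p : ℝ≥0∞} [Fact (1 ≤ p)]
    {i : Fin N} {f g f' g' : LpOn Ω p} (h : HasWeakPartialDeriv Ω i f g)
    (h' : HasWeakPartialDeriv Ω i f' g') :
    HasWeakPartialDeriv Ω i (f + f' : LpOn Ω p) (g + g' : LpOn Ω p) := by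
  have H : HasWeakPartialDeriv Ω i ((f : Eucl N → ℝ) + f') ((g : Eucl N → ℝ) + g') := by
    intro φ
    have hφ : Continuous (φ : Eucl N → ℝ) := (TestFunctionClass.map_contDiff φ).continuous
    have hφs := TestFunctionClass.map_hasCompactSupport φ
    simp only [Pi.add_apply, add_mul]
    rw [integral_add (integrable_mul_of_hasCompactSupport f (continuous_partialDeriv φ i)
        (hasCompactSupport_partialDeriv φ i))
      (integrable_mul_of_hasCompactSupport f' (continuous_partialDeriv φ i)
        (hasCompactSupport_partialDeriv φ i)),
      integral_add (integrable_mul_of_hasCompactSupport g hφ hφs)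
        (integrable_mul_of_hasCompactSupport g' hφ hφs), h φ, h' φ]
    ring
  exact H.congr (Lp.coeFn_add _ _) (Lp.coeFn_add _ _)

theorem HasWeakPartialDeriv.smul {N : ℕ} {Ω : Opens (Eucl N)} {p : ℝ≥0∞} [Fact (1 ≤ p)]
    {i : Fin N} {f g : LpOn Ω p} (c : ℝ) (h : HasWeakPartialDeriv Ω i f g) :
    HasWeakPartialDeriv Ω i (c • f : LpOn Ω p) (c • g : LpOn Ω p) := by
  have H : HasWeakPartialDeriv Ω i (c • (f : Eucl N → ℝ)) (c • (g : Eucl N → ℝ)) := by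
    intro φ
    simp only [Pi.smul_apply, smul_eq_mul, mul_assoc, integral_const_mul]
    rw [h φ]
    ring
  exact H.congr (Lp.coeFn_smul _ _) (Lp.coeFn_smul _ _)

/-- The Sobolev space `W^{2,p}(Ω)`, `1 ≤ p ≤ ∞`. A function `u ∈ L^p(Ω)` whose weak derivatives of
first and second order exist and lie in `L^p(Ω)` is recorded together with these (unique)
derivatives, as `(u, Du, D²u)`. The norm inherited from the product is
`max_{|α| ≤ 2} ‖∂^α u‖_{L^p(Ω)}`, one of the usual equivalent norms of `W^{2,p}(Ω)`. -/
def SobolevW2 {N : ℕ} (Ω : Opens (Eucl N)) (p : ℝ≥0∞) [Fact (1 ≤ p)] :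
    Submodule ℝ (LpOn Ω p × (Fin N → LpOn Ω p) × (Fin N → Fin N → LpOn Ω p)) where
  carrier := {w | (∀ i, HasWeakPartialDeriv Ω i w.1 (w.2.1 i)) ∧
    ∀ i j, HasWeakPartialDeriv Ω j (w.2.1 i) (w.2.2 i j)}
  zero_mem' := ⟨fun i => HasWeakPartialDeriv.zero Ω p i, fun _ j => HasWeakPartialDeriv.zero Ω p j⟩
  add_mem' h h' := ⟨fun i => (h.1 i).add (h'.1 i), fun i j => (h.2 i j).add (h'.2 i j)⟩
  smul_mem' c _ h := ⟨fun i => (h.1 i).smul c, fun i j => (h.2 i j).smul c⟩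

/-- The Hessian matrix `D²u(x)`, formed with the weak second derivatives of `u`. -/
def hessian {N : ℕ} {Ω : Opens (Eucl N)} {p : ℝ≥0∞} [Fact (1 ≤ p)] (u : SobolevW2 Ω p)
    (x : Eucl N) : Matrix (Fin N) (Fin N) ℝ :=
  Matrix.of fun i j => u.1.2.2 i j x

/-- The minor of order `k` of `D²u(x)` with set of rows `P` and set of columns `Q`. -/
def hessianMinor {N k : ℕ} {Ω : Opens (Eucl N)} {p : ℝ≥0∞} [Fact (1 ≤ p)]
    (P Q : Finset (Fin N)) (hP : P.card = k) (hQ : Q.card = k) (u : SobolevW2 Ω p)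
    (x : Eucl N) : ℝ :=
  ((hessian u x).submatrix (P.orderEmbOfFin hP) (Q.orderEmbOfFin hQ)).det

/-- Weak convergence of sequences in a normed space: convergence in the weak topology. -/
def WeakTendsto {X : Type*} [NormedAddCommGroup X] [NormedSpace ℝ X] (u : ℕ → X) (v : X) : Prop :=
  Tendsto (fun n => toWeakSpace ℝ X (u n)) atTop (𝓝 (toWeakSpace ℝ X v))

/-- The signed measure `f dx` on `Ω` for `f ∈ L^1(Ω)`. Mathlib's `SignedMeasure` on `Ω` is a
countably additive real-valued set function on the Borel sets of `Ω`; as `Ω` is an open subset of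
`ℝ^N`, these are exactly the signed Radon measures of finite mass. -/
def densityMeasure {N : ℕ} (Ω : Opens (Eucl N)) (f : Eucl N → ℝ) : SignedMeasure Ω :=
  ((volume : Measure (Eucl N)).comap (Subtype.val : Ω → Eucl N)).withDensityᵥ
    (fun x : Ω => f x)

/-- Weak-* convergence in `M(Ω) = C_0(Ω)*`, the space of finite signed Radon measures: convergence
of the integrals of every continuous function on `Ω` vanishing at infinity on `Ω`
(for bounded `Ω`: at the boundary of `Ω`). -/
def WeakStarTendsto {N : ℕ} {Ω : Opens (Eucl N)} (m : ℕ → SignedMeasure Ω)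
    (m' : SignedMeasure Ω) : Prop :=
  ∀ φ : C₀(Ω, ℝ), Tendsto (fun n => ∫ᵛ x, φ x ∂<•(m n)) atTop (𝓝 (∫ᵛ x, φ x ∂<•m'))

/-- Weak convergence in `L^p(Ω)` of the classes of the functions `f n` to the class of `g`,
including that all of these functions belong to `L^p(Ω)`. -/
def WeakTendstoLp {N : ℕ} (Ω : Opens (Eucl N)) (p : ℝ≥0∞) [Fact (1 ≤ p)]
    (f : ℕ → Eucl N → ℝ) (g : Eucl N → ℝ) : Prop :=
  ∃ (hf : ∀ n, MemLp (f n) p (lebesgueOn Ω)) (hg : MemLp g p (lebesgueOn Ω)),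
    WeakTendsto (X := LpOn Ω p) (fun n => (hf n).toLp (f n)) (hg.toLp g)

end HessianMinors

end

/-!
# Weak continuity of minors of the Hessian

The minor with rows `P` and columns `Q` is the determinant of the matrix of the derivatives
`∂/∂x_q`, `q ∈ Q`, of the `k` functions `∂u/∂x_p`, `p ∈ P`, which lie in `W^{1,k}(Ω)`. Such a
Jacobian determinant is a null Lagrangian, and this makes it weakly continuous.

* *Integration by parts.* The cofactors of a row of a Jacobian matrix are divergence free
  (`sum_sign_mul_partialDeriv_prod_eq_zero`). Hence `∫ φ det Df` does not change, up to the sign,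
  when `φ` and one function `f_i` exchange their places. This holds for smooth functions
  (`integral_mul_det_jacobian`) and by mollification for functions in `W^{1,k}(Ω)`
  (`integral_mul_det_gradMatrix`).
* *Convergence against test functions.* The difference `det Df_n - det Df` is a sum of determinants
  in which one row is the gradient of a component of `f_n - f` and the other rows are bounded in
  `L^k` (`det_sub_det_eq_sum`). After integration by parts, only the component of `f_n - f` itself
  appears in this row. It tends to zero strongly in `L^k` on the support of `φ`, by the theorem of
  Rellich and Kondrachov (`tendsto_eLpNorm_zero_of_weak`), and Hölder's inequality gives
  `∫ φ det Df_n → ∫ φ det Df` (`tendsto_integral_mul_det_gradMatrix`).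
* *Enlarging the class of test functions.* A weakly convergent sequence is bounded, so the minors
  are bounded in `L^1(Ω)`, or in `L^q(Ω)` when `u_n` converges weakly in `W^{2,kq}(Ω)`. Test
  functions are dense in `C_0(Ω)` and in `L^{q'}(Ω)`, and this yields the two kinds of convergence
  (`tendsto_integral_mul_zeroAtInfty`, `tendsto_integral_mul_memLp`). In the second case all
  functionals on `L^q(Ω)` have to be treated; they are represented by functions in `L^{q'}(Ω)`
  (`exists_memLp_forall_eq_integral`).
-/

namespace HessianMinors

/-! ### Integral inequalities -/

/-- Minkowski's integral inequality for an average over a probability measure. -/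
theorem eLpNorm_integral_le_of_ae_le {X Y : Type*} [MeasurableSpace X] [MeasurableSpace Y]
    {μ : Measure X} [SFinite μ] {ν : Measure Y} [IsProbabilityMeasure ν] {F : Y → X → ℝ}
    (hF : Measurable (Function.uncurry F)) {p : ℝ≥0∞} (hp1 : 1 ≤ p) (hp : p ≠ ⊤) {B : ℝ≥0∞}
    (h : ∀ᵐ y ∂ν, eLpNorm (F y) p μ ≤ B) :
    eLpNorm (fun x => ∫ y, F y x ∂ν) p μ ≤ B := by
  have hp0 : p ≠ 0 := (one_pos.trans_le hp1).ne'
  have hpr : 0 < p.toReal := ENNReal.toReal_pos hp0 hp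
  have key : ∀ x, ‖∫ y, F y x ∂ν‖ₑ ^ p.toReal ≤ ∫⁻ y, ‖F y x‖ₑ ^ p.toReal ∂ν := by
    intro x
    have hm : AEStronglyMeasurable (fun y => F y x) ν :=
      (hF.comp (measurable_id.prodMk measurable_const)).aestronglyMeasurable
    have h1 : ‖∫ y, F y x ∂ν‖ₑ ≤ eLpNorm (fun y => F y x) p ν :=
      calc ‖∫ y, F y x ∂ν‖ₑ ≤ ∫⁻ y, ‖F y x‖ₑ ∂ν := enorm_integral_le_lintegral_enorm _
        _ = eLpNorm (fun y => F y x) 1 ν := eLpNorm_one_eq_lintegral_enorm.symm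
        _ ≤ _ := eLpNorm_le_eLpNorm_of_exponent_le hp1 hm
    rw [eLpNorm_eq_lintegral_rpow_enorm_toReal hp0 hp] at h1
    rwa [← ENNReal.le_rpow_inv_iff hpr, ← one_div]
  rw [eLpNorm_eq_lintegral_rpow_enorm_toReal hp0 hp, one_div, ENNReal.rpow_inv_le_iff hpr]
  calc ∫⁻ x, ‖∫ y, F y x ∂ν‖ₑ ^ p.toReal ∂μ
      ≤ ∫⁻ x, ∫⁻ y, ‖F y x‖ₑ ^ p.toReal ∂ν ∂μ := lintegral_mono key
    _ = ∫⁻ y, ∫⁻ x, ‖F y x‖ₑ ^ p.toReal ∂μ ∂ν := by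
        refine lintegral_lintegral_swap ?_
        exact ((hF.comp measurable_swap).enorm.pow_const _).aemeasurable
    _ ≤ ∫⁻ _, B ^ p.toReal ∂ν := by
        refine lintegral_mono_ae (h.mono fun y hy => ?_)
        rw [eLpNorm_eq_lintegral_rpow_enorm_toReal hp0 hp, one_div,
          ENNReal.rpow_inv_le_iff hpr] at hy
        exact hy
    _ = B ^ p.toReal := by simp

/-- On a finite measure space the norm of a larger exponent controls that of a smaller one. -/
theorem exists_eLpNorm_le_mul {X : Type*} [MeasurableSpace X] (μ : Measure X) [IsFiniteMeasure μ]
    {p q : ℝ≥0∞} (hp : 1 ≤ p) (hpq : p ≤ q) :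
    ∃ c : ℝ≥0∞, c ≠ ⊤ ∧ ∀ f : X → ℝ, AEStronglyMeasurable f μ →
      eLpNorm f p μ ≤ c * eLpNorm f q μ := by
  refine ⟨μ Set.univ ^ (1 / p.toReal - 1 / q.toReal), ?_, fun f hf => ?_⟩
  · refine (ENNReal.rpow_lt_top_of_nonneg ?_ (measure_ne_top _ _)).ne
    rcases eq_or_ne q ⊤ with rfl | hq
    · simp
    · exact sub_nonneg.2 (one_div_le_one_div_of_le
        (ENNReal.toReal_pos (one_pos.trans_le hp).ne' (ne_top_of_le_ne_top hq hpq))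
        (ENNReal.toReal_mono hq hpq))
  · rw [mul_comm]
    exact eLpNorm_le_eLpNorm_mul_rpow_measure_univ hpq hf

/-- Hölder's inequality for finitely many factors. -/
theorem eLpNorm_prod_le {ι X : Type*} [MeasurableSpace X] {μ : Measure X} {f : ι → X → ℝ}
    {p : ι → ℝ≥0∞} {s : Finset ι} (hf : ∀ i, AEStronglyMeasurable (f i) μ) :
    eLpNorm (∏ i ∈ s, f i) (∑ i ∈ s, (p i)⁻¹)⁻¹ μ ≤ ∏ i ∈ s, eLpNorm (f i) (p i) μ := by
  induction s using Finset.cons_induction with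
  | empty =>
    by_cases hμ : μ = 0 <;> simp [eLpNormEssSup_const, hμ, Pi.one_def]
  | cons i s hi ih =>
    rw [Finset.prod_cons, Finset.prod_cons]
    have : ENNReal.HolderTriple (p i) (∑ j ∈ s, (p j)⁻¹)⁻¹
        (∑ j ∈ Finset.cons i s hi, (p j)⁻¹)⁻¹ := ⟨by simp⟩
    refine (eLpNorm_smul_le_mul_eLpNorm (p := p i) (q := (∑ j ∈ s, (p j)⁻¹)⁻¹)
      (f := ∏ j ∈ s, f j) (Finset.aestronglyMeasurable_prod _ fun j _ => hf j) (hf i)).trans ?_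
    gcongr

theorem eLpNorm_prod_fin_le {X : Type*} [MeasurableSpace X] {μ : Measure X} {k : ℕ} (hk : 1 ≤ k)
    (q : ℝ≥0∞) {f : Fin k → X → ℝ} (hf : ∀ b, AEStronglyMeasurable (f b) μ) :
    eLpNorm (fun x => ∏ b, f b x) q μ ≤ ∏ b, eLpNorm (f b) (k * q) μ := by
  have hexp : (∑ _b : Fin k, ((k : ℝ≥0∞) * q)⁻¹)⁻¹ = q := by
    have hk0 : (k : ℝ≥0∞) ≠ 0 := by simp; omega
    have hinv : ((k : ℝ≥0∞) * q)⁻¹ = (k : ℝ≥0∞)⁻¹ * q⁻¹ :=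
      ENNReal.mul_inv (Or.inl hk0) (Or.inl (ENNReal.natCast_ne_top k))
    rw [Finset.sum_const, Finset.card_univ, Fintype.card_fin, nsmul_eq_mul, hinv, ← mul_assoc,
      ENNReal.mul_inv_cancel hk0 (ENNReal.natCast_ne_top k), one_mul, inv_inv]
  have h2 := eLpNorm_prod_le (μ := μ) (p := fun _ => (k : ℝ≥0∞) * q) (s := Finset.univ) hf
  have h3 : (∏ b, f b) = fun x => ∏ b, f b x := by
    funext x
    rw [Finset.prod_apply]
  rwa [hexp, h3] at h2

/-- Each of the `k!` products in the Leibniz expansion is estimated by Hölder's inequality. -/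
theorem eLpNorm_det_le {X : Type*} [MeasurableSpace X] {μ : Measure X} {k : ℕ} (hk : 1 ≤ k)
    {q : ℝ≥0∞} (hq : 1 ≤ q) {A : X → Matrix (Fin k) (Fin k) ℝ}
    (hA : ∀ a b, AEStronglyMeasurable (fun x => A x a b) μ) :
    eLpNorm (fun x => (A x).det) q μ ≤
      ∑ σ : Equiv.Perm (Fin k), ∏ b, eLpNorm (fun x => A x (σ b) b) (k * q) μ := by
  have hsum : (fun x => (A x).det) = ∑ σ : Equiv.Perm (Fin k),
      (((Equiv.Perm.sign σ : ℤ) : ℝ) • fun x => ∏ b, A x (σ b) b) := by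
    funext x
    simp [Matrix.det_apply']
  have hprod : ∀ σ : Equiv.Perm (Fin k), AEStronglyMeasurable (fun x => ∏ b, A x (σ b) b) μ :=
    fun σ => Finset.aestronglyMeasurable_fun_prod _ fun b _ => hA _ _
  rw [hsum]
  refine (eLpNorm_sum_le (fun σ _ => (hprod σ).const_smul _) hq).trans ?_
  refine Finset.sum_le_sum fun σ _ => ?_
  have hsign : ‖((Equiv.Perm.sign σ : ℤ) : ℝ)‖ₑ = 1 := by
    rcases Int.units_eq_one_or (Equiv.Perm.sign σ) with h | h <;> simp [h]
  rw [eLpNorm_const_smul, hsign, one_mul]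
  exact eLpNorm_prod_fin_le hk q (f := fun b x => A x (σ b) b) fun b => hA _ _

theorem eLpNorm_det_le_of_forall_le {X : Type*} [MeasurableSpace X] {μ : Measure X} {k : ℕ}
    (hk : 1 ≤ k) {q : ℝ≥0∞} (hq : 1 ≤ q) {A : X → Matrix (Fin k) (Fin k) ℝ}
    (hA : ∀ a b, AEStronglyMeasurable (fun x => A x a b) μ) {C : ℝ≥0∞}
    (hC : ∀ a b, eLpNorm (fun x => A x a b) (k * q) μ ≤ C) :
    eLpNorm (fun x => (A x).det) q μ ≤ Fintype.card (Equiv.Perm (Fin k)) * C ^ k := by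
  refine (eLpNorm_det_le hk hq hA).trans ?_
  refine (Finset.sum_le_sum fun σ _ => Finset.prod_le_prod' fun b _ => hC (σ b) b).trans ?_
  simp

theorem memLp_det {X : Type*} [MeasurableSpace X] {μ : Measure X} {k : ℕ} (hk : 1 ≤ k)
    {q : ℝ≥0∞} (hq : 1 ≤ q) {A : X → Matrix (Fin k) (Fin k) ℝ}
    (hA : ∀ a b, MemLp (fun x => A x a b) (k * q) μ) : MemLp (fun x => (A x).det) q μ := by
  refine ⟨?_, (eLpNorm_det_le hk hq fun a b => (hA a b).1).trans_lt ?_⟩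
  · simp only [Matrix.det_apply]
    exact Finset.aestronglyMeasurable_fun_sum _ fun σ _ =>
      (Finset.aestronglyMeasurable_fun_prod _ fun b _ => (hA _ _).1).const_smul _
  · exact ENNReal.sum_lt_top.2 fun σ _ => ENNReal.prod_lt_top fun b _ => (hA _ _).2

/-- If one row tends to zero in `L^k` and the others stay bounded, the determinant tends to zero in
`L^1`. -/
theorem tendsto_eLpNorm_det_zero {X ι : Type*} [MeasurableSpace X] {μ : Measure X} {l : Filter ι}
    {k : ℕ} (hk : 1 ≤ k) {A : ι → X → Matrix (Fin k) (Fin k) ℝ}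
    (hA : ∀ n a b, AEStronglyMeasurable (fun x => A n x a b) μ) {C : ℝ≥0∞} (hC : C ≠ ⊤)
    (hb : ∀ᶠ n in l, ∀ a b, eLpNorm (fun x => A n x a b) k μ ≤ C) (i : Fin k)
    (hi : ∀ b, Tendsto (fun n => eLpNorm (fun x => A n x i b) k μ) l (𝓝 0)) :
    Tendsto (fun n => eLpNorm (fun x => (A n x).det) 1 μ) l (𝓝 0) := by
  classical
  have hlim : Tendsto (fun n => ∑ σ : Equiv.Perm (Fin k),
      eLpNorm (fun x => A n x i (σ.symm i)) k μ * C ^ (k - 1)) l (𝓝 0) := by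
    have : Tendsto (fun n => ∑ σ : Equiv.Perm (Fin k),
        eLpNorm (fun x => A n x i (σ.symm i)) k μ * C ^ (k - 1)) l
        (𝓝 (∑ _σ : Equiv.Perm (Fin k), 0 * C ^ (k - 1))) :=
      tendsto_finsetSum _ fun σ _ =>
        ENNReal.Tendsto.mul_const (hi _) (Or.inr (ENNReal.pow_ne_top hC))
    simpa using this
  refine tendsto_of_tendsto_of_tendsto_of_le_of_le' tendsto_const_nhds hlim
    (Eventually.of_forall fun _ => zero_le) (hb.mono fun n hn => ?_)
  refine (eLpNorm_det_le hk le_rfl (hA n)).trans (Finset.sum_le_sum fun σ _ => ?_)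
  rw [mul_one, ← Finset.mul_prod_erase _ _ (Finset.mem_univ (σ.symm i)), Equiv.apply_symm_apply]
  gcongr
  refine (Finset.prod_le_prod' fun b _ => hn (σ b) b).trans ?_
  simp

/-! ### Changing the rows of a determinant one at a time -/

/-- The matrix with the rows of `A` before the row `i`, the difference of the two rows at `i`, and
the rows of `B` after it. -/
def rowInterpolation {k : ℕ} (A B : Matrix (Fin k) (Fin k) ℝ) (i : Fin k) :
    Matrix (Fin k) (Fin k) ℝ :=
  fun a => if a < i then A a else if a = i then A i - B i else B a

theorem det_sub_det_eq_sum {k : ℕ} (A B : Matrix (Fin k) (Fin k) ℝ) :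
    A.det - B.det = ∑ i, (rowInterpolation A B i).det := by
  -- `T m` is the determinant with the first `m` rows from `A` and the others from `B`; the sum
  -- telescopes.
  set T : ℕ → ℝ := fun m => Matrix.det (fun a : Fin k => if (a : ℕ) < m then A a else B a) with hT
  have h0 : T 0 = B.det := by simp [hT]
  have hk : T k = A.det := by simp [hT]
  rw [← h0, ← hk, ← Finset.sum_range_sub, Finset.sum_range]
  refine Finset.sum_congr rfl fun i _ => ?_
  set M : Matrix (Fin k) (Fin k) ℝ := fun a => if a < i then A a else B a with hM
  have e1 : (fun a : Fin k => if (a : ℕ) < i + 1 then A a else B a) = M.updateRow i (A i) := by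
    funext a
    rcases lt_trichotomy a i with h | h | h
    · have h1 : (a : ℕ) < i := h
      rw [Matrix.updateRow_ne h.ne]
      simp [hM, h, h1.trans (Nat.lt_succ_self _)]
    · subst h; simp
    · have h1 : (i : ℕ) < a := h
      rw [Matrix.updateRow_ne h.ne']
      simp [hM, h.not_gt, show ¬ (a : ℕ) < i + 1 by omega]
  have e2 : (fun a : Fin k => if (a : ℕ) < i then A a else B a) = M.updateRow i (B i) := by
    funext a
    by_cases h : a = i
    · subst h; simp
    · rw [Matrix.updateRow_ne h]
      simp [hM]
  have e3 : rowInterpolation A B i = M.updateRow i (A i - B i) := by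
    funext a
    by_cases h : a = i
    · subst h; simp [rowInterpolation]
    · rw [Matrix.updateRow_ne h]
      simp [hM, rowInterpolation, h]
  have e4 : A i = (A i - B i) + B i := by simp
  simp only [hT]
  rw [e1, e2, e3]
  conv_lhs => rw [e4]
  rw [Matrix.det_updateRow_add]
  simp

/-- Determinants depend continuously in `L^1` on their entries in `L^k`. -/
theorem tendsto_eLpNorm_det_sub_det {X ι : Type*} [MeasurableSpace X] {μ : Measure X}
    {l : Filter ι} {k : ℕ} (hk : 1 ≤ k) {A : ι → X → Matrix (Fin k) (Fin k) ℝ}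
    {B : X → Matrix (Fin k) (Fin k) ℝ}
    (hA : ∀ n a b, AEStronglyMeasurable (fun x => A n x a b) μ)
    (hB : ∀ a b, MemLp (fun x => B x a b) k μ)
    (h : ∀ a b, Tendsto (fun n => eLpNorm (fun x => A n x a b - B x a b) k μ) l (𝓝 0)) :
    Tendsto (fun n => eLpNorm (fun x => (A n x).det - (B x).det) 1 μ) l (𝓝 0) := by
  have hk1 : (1 : ℝ≥0∞) ≤ k := Nat.one_le_cast.2 hk
  set D : ℝ≥0∞ := ∑ a, ∑ b, eLpNorm (fun x => B x a b) k μ with hD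
  have hDtop : D ≠ ⊤ := by
    simp only [hD]
    exact (ENNReal.sum_lt_top.2 fun a _ => ENNReal.sum_lt_top.2 fun b _ => (hB a b).2).ne
  have hBD : ∀ a b, eLpNorm (fun x => B x a b) k μ ≤ D := fun a b =>
    (Finset.single_le_sum (f := fun b => eLpNorm (fun x => B x a b) k μ)
      (fun _ _ => zero_le) (Finset.mem_univ b)).trans
      (Finset.single_le_sum (f := fun a => ∑ b, eLpNorm (fun x => B x a b) k μ)
      (fun _ _ => zero_le) (Finset.mem_univ a))
  have hmeas : ∀ i n a b, AEStronglyMeasurable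
      (fun x => rowInterpolation (A n x) (B x) i a b) μ := by
    intro i n a b
    unfold rowInterpolation
    split_ifs
    · exact hA n a b
    · exact (hA n i b).sub (hB i b).1
    · exact (hB a b).1
  have hsmall : ∀ᶠ n in l, ∀ a b, eLpNorm (fun x => A n x a b - B x a b) k μ ≤ 1 := by
    rw [eventually_all]; intro a
    rw [eventually_all]; intro b
    exact (h a b).eventually (ge_mem_nhds one_pos)
  have hzero : ∀ i : Fin k,
      Tendsto (fun n => eLpNorm (fun x => (rowInterpolation (A n x) (B x) i).det) 1 μ) l (𝓝 0) := by
    intro i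
    refine tendsto_eLpNorm_det_zero hk (hmeas i) (C := D + 1) (by simp [hDtop]) ?_ i ?_
    · filter_upwards [hsmall] with n hn a b
      unfold rowInterpolation
      split_ifs
      · calc eLpNorm (fun x => A n x a b) k μ
            = eLpNorm ((fun x => B x a b) + fun x => A n x a b - B x a b) k μ := by
              congr 1; funext x; simp
          _ ≤ _ := (eLpNorm_add_le (hB a b).1 ((hA n a b).sub (hB a b).1) hk1).trans
              (add_le_add (hBD a b) (hn a b))
      · exact (hn i b).trans le_add_self
      · exact (hBD a b).trans le_self_add
    · intro b
      simpa [rowInterpolation] using h i b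
  have hsum : Tendsto (fun n => ∑ i, eLpNorm (fun x => (rowInterpolation (A n x) (B x) i).det) 1 μ)
      l (𝓝 0) := by
    simpa using tendsto_finsetSum Finset.univ fun i _ => hzero i
  refine tendsto_of_tendsto_of_tendsto_of_le_of_le tendsto_const_nhds hsum
    (fun _ => zero_le) fun n => ?_
  have e : (fun x => (A n x).det - (B x).det) =
      ∑ i, fun x => (rowInterpolation (A n x) (B x) i).det := by
    funext x; simp [det_sub_det_eq_sum]
  simp only [e]
  refine eLpNorm_sum_le (fun i _ => ?_) le_rfl
  simp only [Matrix.det_apply]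
  exact Finset.aestronglyMeasurable_fun_sum _ fun σ _ =>
    (Finset.aestronglyMeasurable_fun_prod _ fun b _ => hmeas _ _ _ _).const_smul _

/-! ### Jacobian determinants of smooth functions -/

variable {N k : ℕ}

theorem contDiff_partialDeriv {f : Eucl N → ℝ} (hf : ContDiff ℝ (⊤ : ℕ∞) f) (i : Fin N) :
    ContDiff ℝ (⊤ : ℕ∞) (partialDeriv f i) :=
  (hf.fderiv_right (m := (⊤ : ℕ∞)) (by simp)).clm_apply contDiff_const

theorem partialDeriv_comm {f : Eucl N → ℝ} (hf : ContDiff ℝ (⊤ : ℕ∞) f) (i j : Fin N)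
    (x : Eucl N) : partialDeriv (partialDeriv f i) j x = partialDeriv (partialDeriv f j) i x := by
  have hd : DifferentiableAt ℝ (fderiv ℝ f) x :=
    ((hf.fderiv_right (m := (⊤ : ℕ∞)) (by simp)).differentiable (by simp)) x
  have key : ∀ a b : Fin N, partialDeriv (partialDeriv f a) b x =
      fderiv ℝ (fderiv ℝ f) x (EuclideanSpace.single b 1) (EuclideanSpace.single a 1) := by
    intro a b
    have : HasFDerivAt (partialDeriv f a) ((ContinuousLinearMap.apply ℝ ℝ
        (EuclideanSpace.single a (1 : ℝ))).comp (fderiv ℝ (fderiv ℝ f) x)) x :=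
      (ContinuousLinearMap.apply ℝ ℝ (EuclideanSpace.single a (1 : ℝ))).hasFDerivAt.comp x
        hd.hasFDerivAt
    simp [partialDeriv, this.fderiv]
  rw [key, key]
  exact ((contDiff_infty.1 hf 2).contDiffAt.isSymmSndFDerivAt (n := 2) (by simp)) _ _

theorem partialDeriv_eq_zero_of_notMem_tsupport {φ : Eucl N → ℝ} {x : Eucl N}
    (hx : x ∉ tsupport φ) (d : Fin N) : partialDeriv φ d x = 0 := by
  have : fderiv ℝ φ x = 0 := by
    by_contra hne
    exact hx (support_fderiv_subset ℝ hne)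
  simp [partialDeriv, this]

theorem integral_partialDeriv_mul {f g : Eucl N → ℝ} (hf : ContDiff ℝ (⊤ : ℕ∞) f)
    (hfc : HasCompactSupport f) (hg : ContDiff ℝ (⊤ : ℕ∞) g) (i : Fin N) :
    ∫ x, partialDeriv f i x * g x = - ∫ x, f x * partialDeriv g i x := by
  have hpf : HasCompactSupport (partialDeriv f i) := hfc.fderiv_apply (𝕜 := ℝ) _
  have h := integral_mul_fderiv_eq_neg_fderiv_mul_of_integrable (μ := (volume : Measure (Eucl N)))
    (f := f) (g := g) (v := EuclideanSpace.single i 1)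
    (((contDiff_partialDeriv hf i).continuous.mul hg.continuous).integrable_of_hasCompactSupport
      hpf.mul_right)
    ((hf.continuous.mul (contDiff_partialDeriv hg i).continuous).integrable_of_hasCompactSupport
      hfc.mul_right)
    ((hf.continuous.mul hg.continuous).integrable_of_hasCompactSupport hfc.mul_right)
    (fun x _ => (hf.differentiable (by simp)) x) (fun x _ => (hg.differentiable (by simp)) x)
  unfold partialDeriv
  rw [h, neg_neg]

/-- The matrix with entries `∂v_a/∂x_{c b}`. -/
noncomputable def jacobian (c : Fin k → Fin N) (v : Fin k → Eucl N → ℝ) (x : Eucl N) :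
    Matrix (Fin k) (Fin k) ℝ :=
  fun a b => partialDeriv (v a) (c b) x

theorem partialDeriv_prod {ι : Type*} [DecidableEq ι] {s : Finset ι} {f : ι → Eucl N → ℝ}
    (hf : ∀ a, ContDiff ℝ (⊤ : ℕ∞) (f a)) (d : Fin N) (x : Eucl N) :
    partialDeriv (fun x => ∏ a ∈ s, f a x) d x =
      ∑ a ∈ s, (∏ b ∈ s.erase a, f b x) * partialDeriv (f a) d x := by
  unfold partialDeriv
  rw [fderiv_finsetProd fun a _ => ((hf a).differentiable (by simp)) x]
  simp

/-- The cofactors of a row of a Jacobian matrix are divergence free: the second derivatives cancel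
in pairs. -/
theorem sum_sign_mul_partialDeriv_prod_eq_zero (c : Fin k → Fin N) {v : Fin k → Eucl N → ℝ}
    (hv : ∀ a, ContDiff ℝ (⊤ : ℕ∞) (v a)) (i : Fin k) (x : Eucl N) :
    ∑ σ : Equiv.Perm (Fin k), ((Equiv.Perm.sign σ : ℤ) : ℝ) *
      partialDeriv (fun x => ∏ a ∈ Finset.univ.erase i, partialDeriv (v a) (c (σ a)) x)
        (c (σ i)) x = 0 := by
  have h1 : ∀ σ : Equiv.Perm (Fin k),
      partialDeriv (fun x => ∏ a ∈ Finset.univ.erase i, partialDeriv (v a) (c (σ a)) x)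
        (c (σ i)) x = ∑ a ∈ Finset.univ.erase i,
        (∏ b ∈ (Finset.univ.erase i).erase a, partialDeriv (v b) (c (σ b)) x) *
          partialDeriv (partialDeriv (v a) (c (σ a))) (c (σ i)) x :=
    fun σ => partialDeriv_prod (fun a => contDiff_partialDeriv (hv a) _) _ _
  simp only [h1, Finset.mul_sum]
  rw [Finset.sum_comm]
  refine Finset.sum_eq_zero fun a ha => ?_
  have hai : a ≠ i := Finset.ne_of_mem_erase ha
  -- Exchanging `σ i` and `σ a` changes the sign and leaves `∂_{σ a} ∂_{σ i} v_a` unchanged.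
  refine Finset.sum_involution (fun σ _ => σ * Equiv.swap i a) ?_ ?_ ?_ ?_
  · intro σ _
    have hprod : ∏ b ∈ (Finset.univ.erase i).erase a,
        partialDeriv (v b) (c ((σ * Equiv.swap i a) b)) x =
        ∏ b ∈ (Finset.univ.erase i).erase a, partialDeriv (v b) (c (σ b)) x := by
      refine Finset.prod_congr rfl fun b hb => ?_
      rw [Finset.mem_erase, Finset.mem_erase] at hb
      rw [Equiv.Perm.mul_apply, Equiv.swap_apply_of_ne_of_ne hb.2.1 hb.1]
    rw [hprod]
    simp only [Equiv.Perm.mul_apply, Equiv.swap_apply_left, Equiv.swap_apply_right,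
      Equiv.Perm.sign_mul, Equiv.Perm.sign_swap hai.symm]
    rw [partialDeriv_comm (hv a) (c (σ i)) (c (σ a))]
    push_cast
    ring
  · intro σ _ _ h
    have := congrArg (fun τ : Equiv.Perm (Fin k) => σ.symm (τ i)) h
    simp at this
    exact hai this
  · intros; exact Finset.mem_univ _
  · intro σ _
    simp [mul_assoc]

/-- Expanding along the row `i` and integrating by parts leaves the divergence of the cofactors. -/
theorem integral_det_jacobian_eq_zero (c : Fin k → Fin N) {v : Fin k → Eucl N → ℝ}
    (hv : ∀ a, ContDiff ℝ (⊤ : ℕ∞) (v a)) (i : Fin k) (hi : HasCompactSupport (v i)) :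
    ∫ x, (jacobian c v x).det = 0 := by
  set F : Equiv.Perm (Fin k) → Eucl N → ℝ := fun σ x =>
    ∏ a ∈ Finset.univ.erase i, partialDeriv (v a) (c (σ a)) x with hF
  have hFs : ∀ σ, ContDiff ℝ (⊤ : ℕ∞) (F σ) := fun σ =>
    contDiff_prod fun a _ => contDiff_partialDeriv (hv a) _
  have hdet : ∀ x, (jacobian c v x).det = ∑ σ : Equiv.Perm (Fin k),
      ((Equiv.Perm.sign σ : ℤ) : ℝ) * (partialDeriv (v i) (c (σ i)) x * F σ x) := by
    intro x
    rw [← Matrix.det_transpose, Matrix.det_apply']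
    refine Finset.sum_congr rfl fun σ _ => ?_
    rw [← Finset.mul_prod_erase _ _ (Finset.mem_univ i)]
    rfl
  have hpi : ∀ d, HasCompactSupport (partialDeriv (v i) d) := fun d => hi.fderiv_apply (𝕜 := ℝ) _
  simp only [hdet]
  rw [integral_finsetSum Finset.univ fun σ _ => Integrable.const_mul (f := fun x =>
    partialDeriv (v i) (c (σ i)) x * F σ x) (((contDiff_partialDeriv (hv i) _).continuous.mul
    (hFs σ).continuous).integrable_of_hasCompactSupport (hpi _).mul_right) _]
  simp only [integral_const_mul, integral_partialDeriv_mul (hv i) hi (hFs _)]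
  have hint : ∀ σ : Equiv.Perm (Fin k),
      Integrable (fun x => v i x * partialDeriv (F σ) (c (σ i)) x) := fun σ =>
    ((hv i).continuous.mul (contDiff_partialDeriv (hFs σ) _).continuous).integrable_of_hasCompactSupport
      hi.mul_right
  have hneg : ∀ σ : Equiv.Perm (Fin k), ((Equiv.Perm.sign σ : ℤ) : ℝ) *
      -∫ x, v i x * partialDeriv (F σ) (c (σ i)) x =
      ∫ x, -((Equiv.Perm.sign σ : ℤ) : ℝ) * (v i x * partialDeriv (F σ) (c (σ i)) x) := by
    intro σ
    rw [integral_const_mul]; ring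
  simp only [hneg]
  rw [← integral_finsetSum _ fun σ _ => (hint σ).const_mul _]
  refine integral_eq_zero_of_ae (Eventually.of_forall fun x => ?_)
  have := sum_sign_mul_partialDeriv_prod_eq_zero c hv i x
  calc ∑ σ : Equiv.Perm (Fin k), -((Equiv.Perm.sign σ : ℤ) : ℝ) *
        (v i x * partialDeriv (F σ) (c (σ i)) x)
      = -v i x * ∑ σ : Equiv.Perm (Fin k), ((Equiv.Perm.sign σ : ℤ) : ℝ) *
        partialDeriv (F σ) (c (σ i)) x := by
        rw [Finset.mul_sum]; exact Finset.sum_congr rfl fun σ _ => by ring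
    _ = 0 := by rw [this, mul_zero]

theorem continuous_det_jacobian (c : Fin k → Fin N) {v : Fin k → Eucl N → ℝ}
    (hv : ∀ a, ContDiff ℝ (⊤ : ℕ∞) (v a)) : Continuous fun x => (jacobian c v x).det :=
  Continuous.matrix_det (continuous_matrix fun a _ => (contDiff_partialDeriv (hv a) _).continuous)

/-- Integration by parts for Jacobian determinants of smooth functions: the weight `φ` changes
places with the function in the row `i`. -/
theorem integral_mul_det_jacobian (c : Fin k → Fin N) {v : Fin k → Eucl N → ℝ}
    (hv : ∀ a, ContDiff ℝ (⊤ : ℕ∞) (v a)) {φ : Eucl N → ℝ} (hφ : ContDiff ℝ (⊤ : ℕ∞) φ)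
    (hφc : HasCompactSupport φ) (i : Fin k) :
    ∫ x, φ x * (jacobian c v x).det =
      - ∫ x, v i x * ((jacobian c v x).updateRow i fun b => partialDeriv φ (c b) x).det := by
  have hupd : ∀ (w : Eucl N → ℝ) x, jacobian c (Function.update v i w) x =
      (jacobian c v x).updateRow i fun b => partialDeriv w (c b) x := by
    intro w x
    ext a b
    by_cases h : a = i
    · subst h; simp [jacobian]
    · simp [jacobian, h]
  have hsm : ∀ w, ContDiff ℝ (⊤ : ℕ∞) w → ∀ a, ContDiff ℝ (⊤ : ℕ∞) (Function.update v i w a) := by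
    intro w hw a
    by_cases h : a = i
    · subst h; simpa using hw
    · simpa [h] using hv a
  -- Replacing the function in the row `i` by `φ v_i` gives it compact support.
  have h0 := integral_det_jacobian_eq_zero c (hsm _ (hφ.mul (hv i))) i
    (by rw [Function.update_self]; exact hφc.mul_right)
  have hsplit : ∀ x, (jacobian c (Function.update v i fun x => φ x * v i x) x).det =
      φ x * (jacobian c v x).det +
        v i x * ((jacobian c v x).updateRow i fun b => partialDeriv φ (c b) x).det := by
    intro x
    have hrow : (fun b => partialDeriv (fun x => φ x * v i x) (c b) x) =
        φ x • jacobian c v x i + v i x • fun b => partialDeriv φ (c b) x := by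
      funext b
      have : fderiv ℝ (fun x => φ x * v i x) x = φ x • fderiv ℝ (v i) x + v i x • fderiv ℝ φ x :=
        fderiv_fun_mul ((hφ.differentiable (by simp)) x) (((hv i).differentiable (by simp)) x)
      simp [partialDeriv, this, jacobian]
    rw [hupd, hrow, Matrix.det_updateRow_add, Matrix.det_updateRow_smul, Matrix.det_updateRow_smul]
    simp
  simp only [hsplit] at h0
  rw [integral_add] at h0
  · linarith
  · exact (hφ.continuous.mul (continuous_det_jacobian c hv)).integrable_of_hasCompactSupport
      hφc.mul_right
  · refine ((hv i).continuous.mul ?_).integrable_of_hasCompactSupport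
      (hφc.mono' ?_)
    · simpa only [hupd] using continuous_det_jacobian c (hsm φ hφ)
    · intro x hx
      by_contra hxs
      have hz : (fun b => partialDeriv φ (c b) x) = 0 := by
        funext b
        exact partialDeriv_eq_zero_of_notMem_tsupport hxs _
      apply hx
      change v i x * ((jacobian c v x).updateRow i fun b => partialDeriv φ (c b) x).det = 0
      rw [hz, Matrix.det_eq_zero_of_row_eq_zero i (by simp), mul_zero]

/-! ### Mollification -/

/-- The convolution of `f` with the normalized bump function `φ`. -/
noncomputable def mollify (φ : ContDiffBump (0 : Eucl N)) (f : Eucl N → ℝ) : Eucl N → ℝ :=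
  MeasureTheory.convolution (φ.normed volume) f (ContinuousLinearMap.lsmul ℝ ℝ) volume

theorem mollify_apply (φ : ContDiffBump (0 : Eucl N)) (f : Eucl N → ℝ) (x : Eucl N) :
    mollify φ f x = ∫ y, φ.normed volume y * f (x - y) := by
  simp [mollify, convolution_def]

theorem mollify_apply' (φ : ContDiffBump (0 : Eucl N)) (f : Eucl N → ℝ) (x : Eucl N) :
    mollify φ f x = ∫ y, f y * φ.normed volume (x - y) := by
  simp [mollify, convolution_eq_swap, mul_comm]

theorem contDiff_mollify (φ : ContDiffBump (0 : Eucl N)) {f : Eucl N → ℝ}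
    (hf : LocallyIntegrable f) : ContDiff ℝ (⊤ : ℕ∞) (mollify φ f) :=
  φ.hasCompactSupport_normed.contDiff_convolution_left _ φ.contDiff_normed hf

theorem integrable_bump_mul_comp_sub (φ : ContDiffBump (0 : Eucl N)) {f : Eucl N → ℝ}
    (hf : LocallyIntegrable f) (x : Eucl N) :
    Integrable fun y => φ.normed volume y * f (x - y) := by
  have := (φ.hasCompactSupport_normed (μ := (volume : Measure (Eucl N)))).convolutionExists_left
    (ContinuousLinearMap.lsmul ℝ ℝ) φ.continuous_normed hf x
  simpa [ConvolutionExistsAt] using this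

/-- The probability measure whose density is the normalized bump function `φ`. -/
noncomputable def bumpMeasure (φ : ContDiffBump (0 : Eucl N)) : Measure (Eucl N) :=
  volume.withDensity fun y => ENNReal.ofReal (φ.normed volume y)

instance (φ : ContDiffBump (0 : Eucl N)) : IsProbabilityMeasure (bumpMeasure φ) := by
  constructor
  rw [bumpMeasure, withDensity_apply _ MeasurableSet.univ, Measure.restrict_univ,
    ← ofReal_integral_eq_lintegral_ofReal φ.integrable_normed
      (Eventually.of_forall fun y => φ.nonneg_normed y), φ.integral_normed, ENNReal.ofReal_one]

theorem integral_bumpMeasure (φ : ContDiffBump (0 : Eucl N)) (g : Eucl N → ℝ) :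
    ∫ y, g y ∂(bumpMeasure φ) = ∫ y, φ.normed volume y * g y := by
  have hm : Measurable fun y => ENNReal.ofReal (φ.normed (volume : Measure (Eucl N)) y) :=
    φ.continuous_normed.measurable.ennreal_ofReal
  rw [bumpMeasure, integral_withDensity_eq_integral_toReal_smul hm
    (Eventually.of_forall fun y => ENNReal.ofReal_lt_top)]
  refine integral_congr_ae (Eventually.of_forall fun y => ?_)
  simp [ENNReal.toReal_ofReal (φ.nonneg_normed y)]

theorem ae_bumpMeasure (φ : ContDiffBump (0 : Eucl N)) {P : Eucl N → Prop}
    (h : ∀ y ∈ Metric.ball (0 : Eucl N) φ.rOut, P y) : ∀ᵐ y ∂(bumpMeasure φ), P y := by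
  have hm : Measurable fun y => ENNReal.ofReal (φ.normed (volume : Measure (Eucl N)) y) :=
    φ.continuous_normed.measurable.ennreal_ofReal
  rw [bumpMeasure, ae_withDensity_iff hm]
  refine Eventually.of_forall fun y hy => h y ?_
  rw [← φ.support_normed_eq (μ := (volume : Measure (Eucl N)))]
  intro h0
  exact hy (by rw [h0, ENNReal.ofReal_zero])

/-- A function differs from its mollification at most as much as from its small translations, because
the mollification is an average of these. -/
theorem eLpNorm_mollify_sub_le (φ : ContDiffBump (0 : Eucl N)) {f : Eucl N → ℝ}
    (hf : LocallyIntegrable f) (hfm : Measurable f) {p : ℝ≥0∞} (hp1 : 1 ≤ p) (hp : p ≠ ⊤)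
    {μ : Measure (Eucl N)} [SFinite μ] {B : ℝ≥0∞}
    (h : ∀ y ∈ Metric.ball (0 : Eucl N) φ.rOut, eLpNorm (fun x => f (x - y) - f x) p μ ≤ B) :
    eLpNorm (fun x => mollify φ f x - f x) p μ ≤ B := by
  have e : (fun x => mollify φ f x - f x) = fun x => ∫ y, (f (x - y) - f x) ∂(bumpMeasure φ) := by
    funext x
    rw [integral_bumpMeasure, mollify_apply]
    simp only [mul_sub]
    rw [integral_sub (integrable_bump_mul_comp_sub φ hf x) (φ.integrable_normed.mul_const _),
      integral_mul_const, φ.integral_normed, one_mul]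
  rw [e]
  refine eLpNorm_integral_le_of_ae_le (F := fun y x => f (x - y) - f x) ?_ hp1 hp
    (ae_bumpMeasure φ h)
  exact (hfm.comp (measurable_snd.sub measurable_fst)).sub (hfm.comp measurable_snd)

theorem eLpNorm_comp_sub {f : Eucl N → ℝ} (hfm : Measurable f) {p : ℝ≥0∞} (y : Eucl N) :
    eLpNorm (fun x => f (x - y)) p volume = eLpNorm f p volume :=
  eLpNorm_comp_measurePreserving hfm.aestronglyMeasurable (measurePreserving_sub_right volume y)

theorem eLpNorm_mollify_le (φ : ContDiffBump (0 : Eucl N)) {f : Eucl N → ℝ}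
    (hfm : Measurable f) {p : ℝ≥0∞} (hp1 : 1 ≤ p) (hp : p ≠ ⊤) :
    eLpNorm (mollify φ f) p volume ≤ eLpNorm f p volume := by
  have e : mollify φ f = fun x => ∫ y, f (x - y) ∂(bumpMeasure φ) := by
    funext x
    rw [integral_bumpMeasure, mollify_apply]
  rw [e]
  refine eLpNorm_integral_le_of_ae_le (F := fun y x => f (x - y)) ?_ hp1 hp
    (ae_bumpMeasure φ fun y _ => (eLpNorm_comp_sub hfm y).le)
  exact hfm.comp (measurable_snd.sub measurable_fst)

/-- Translations are continuous in `L^p`. -/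
theorem tendsto_eLpNorm_comp_sub_sub {f : Eucl N → ℝ} {p : ℝ≥0∞} (hp1 : 1 ≤ p) (hp : p ≠ ⊤)
    (hf : MemLp f p volume) :
    Tendsto (fun y => eLpNorm (fun x => f (x - y) - f x) p volume) (𝓝 0) (𝓝 0) := by
  have : Fact (1 ≤ p) := ⟨hp1⟩
  let g : Eucl N → C(Eucl N, Eucl N) := fun y => ⟨fun x => x - y, by fun_prop⟩
  have hg : Continuous g := ContinuousMap.continuous_of_continuous_uncurry _ (by
    change Continuous fun z : Eucl N × Eucl N => z.2 - z.1
    fun_prop)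
  have hgm : ∀ y, MeasurePreserving (g y) volume volume := fun y =>
    measurePreserving_sub_right volume y
  have h1 := Filter.Tendsto.compMeasurePreservingLp (tendsto_const_nhds (x := hf.toLp f))
    (hg.tendsto 0) hgm (hgm 0) hp
  have h2 := tendsto_iff_edist_tendsto_0.1 h1
  refine h2.congr fun y => ?_
  rw [Lp.edist_def]
  have e0 : (Lp.compMeasurePreserving (g 0) (hgm 0) (hf.toLp f) : Eucl N → ℝ) =ᵐ[volume] f := by
    refine (Lp.coeFn_compMeasurePreserving _ _).trans ?_
    refine ((hgm 0).quasiMeasurePreserving.ae_eq_comp hf.coeFn_toLp).trans ?_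
    exact Eventually.of_forall fun x => by simp [g]
  have e1 : (Lp.compMeasurePreserving (g y) (hgm y) (hf.toLp f) : Eucl N → ℝ) =ᵐ[volume]
      fun x => f (x - y) := by
    refine (Lp.coeFn_compMeasurePreserving _ _).trans ?_
    exact (hgm y).quasiMeasurePreserving.ae_eq_comp hf.coeFn_toLp
  exact eLpNorm_congr_ae (e1.sub e0)

/-- A bump function centred at the origin with support of radius `r`. -/
noncomputable def bump (N : ℕ) (r : ℝ) (hr : 0 < r) : ContDiffBump (0 : Eucl N) :=
  ⟨r / 2, r, half_pos hr, half_lt_self hr⟩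

/-- Bump functions at the origin whose supports shrink to a point. -/
noncomputable def bumpSeq (N : ℕ) (n : ℕ) : ContDiffBump (0 : Eucl N) :=
  bump N (1 / ((n : ℝ) + 1)) Nat.one_div_pos_of_nat

theorem tendsto_bumpSeq_rOut (N : ℕ) : Tendsto (fun n => (bumpSeq N n).rOut) atTop (𝓝 0) :=
  tendsto_one_div_add_atTop_nhds_zero_nat

theorem tendsto_eLpNorm_mollify_sub {f : Eucl N → ℝ} {p : ℝ≥0∞} (hp1 : 1 ≤ p) (hp : p ≠ ⊤)
    (hf : MemLp f p volume) (hfm : Measurable f) :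
    Tendsto (fun n => eLpNorm (fun x => mollify (bumpSeq N n) f x - f x) p volume) atTop (𝓝 0) := by
  rw [ENNReal.tendsto_nhds_zero]
  intro ε hε
  have h := (ENNReal.tendsto_nhds_zero.1 (tendsto_eLpNorm_comp_sub_sub hp1 hp hf)) ε hε
  obtain ⟨δ, hδ, hball⟩ := Metric.eventually_nhds_iff_ball.1 h
  filter_upwards [(tendsto_bumpSeq_rOut N).eventually (gt_mem_nhds hδ)] with n hn
  refine eLpNorm_mollify_sub_le _ (hf.locallyIntegrable hp1) hfm hp1 hp fun y hy => ?_
  exact hball y (Metric.ball_subset_ball hn.le hy)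

/-! ### Weakly differentiable functions and their mollifications -/

/-- The extension by zero of a function on `Ω`; values outside `Ω` are discarded. -/
noncomputable def zeroExt (Ω : Opens (Eucl N)) (f : Eucl N → ℝ) : Eucl N → ℝ :=
  Set.indicator (Ω : Set (Eucl N)) f

theorem measurable_zeroExt {Ω : Opens (Eucl N)} {f : Eucl N → ℝ} (hf : Measurable f) :
    Measurable (zeroExt Ω f) := hf.indicator Ω.isOpen.measurableSet

theorem eLpNorm_zeroExt {Ω : Opens (Eucl N)} {f : Eucl N → ℝ} {p : ℝ≥0∞} :
    eLpNorm (zeroExt Ω f) p volume = eLpNorm f p (lebesgueOn Ω) :=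
  eLpNorm_indicator_eq_eLpNorm_restrict Ω.isOpen.measurableSet

theorem memLp_zeroExt {Ω : Opens (Eucl N)} {f : Eucl N → ℝ} {p : ℝ≥0∞}
    (hf : MemLp f p (lebesgueOn Ω)) : MemLp (zeroExt Ω f) p volume :=
  (memLp_indicator_iff_restrict Ω.isOpen.measurableSet).2 hf

theorem mollify_zeroExt (φ : ContDiffBump (0 : Eucl N)) {Ω : Opens (Eucl N)} {f : Eucl N → ℝ}
    (x : Eucl N) :
    mollify φ (zeroExt Ω f) x = ∫ y, f y * φ.normed volume (x - y) ∂(lebesgueOn Ω) := by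
  rw [mollify_apply', ← integral_indicator Ω.isOpen.measurableSet]
  refine integral_congr_ae (Eventually.of_forall fun y => ?_)
  by_cases hy : y ∈ (Ω : Set (Eucl N)) <;> simp [zeroExt, hy]

/-- The function `y ↦ φ(x - y)` as a test function on `Ω`. -/
noncomputable def bumpTest (φ : ContDiffBump (0 : Eucl N)) {Ω : Opens (Eucl N)} (x : Eucl N)
    (hx : Metric.closedBall x φ.rOut ⊆ Ω) : TestFunction Ω ℝ (⊤ : ℕ∞) where
  toFun y := φ.normed volume (x - y)
  contDiff' := φ.contDiff_normed.comp (contDiff_const.sub contDiff_id)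
  hasCompactSupport' := by
    refine HasCompactSupport.intro (isCompact_closedBall x φ.rOut) fun y hy => ?_
    rw [← Function.notMem_support, φ.support_normed_eq]
    intro h
    apply hy
    rw [Metric.mem_ball, dist_zero_right] at h
    rw [Metric.mem_closedBall, dist_comm, dist_eq_norm]
    exact h.le
  tsupport_subset' := by
    refine (closure_minimal (fun y hy => ?_) Metric.isClosed_closedBall).trans hx
    have h : x - y ∈ Function.support (φ.normed (volume : Measure (Eucl N))) := hy
    rw [φ.support_normed_eq, Metric.mem_ball, dist_zero_right] at h
    rw [Metric.mem_closedBall, dist_comm, dist_eq_norm]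
    exact h.le

theorem bumpTest_apply (φ : ContDiffBump (0 : Eucl N)) {Ω : Opens (Eucl N)} (x : Eucl N)
    (hx : Metric.closedBall x φ.rOut ⊆ Ω) :
    (bumpTest φ x hx : Eucl N → ℝ) = fun y => φ.normed volume (x - y) := rfl

theorem partialDeriv_comp_sub_left {ρ : Eucl N → ℝ} (hρ : Differentiable ℝ ρ) (i : Fin N)
    (x t : Eucl N) : partialDeriv (fun y => ρ (x - y)) i t = - partialDeriv ρ i (x - t) := by
  have h1 : HasFDerivAt (fun y => ρ (x - y))
      ((fderiv ℝ ρ (x - t)).comp (-ContinuousLinearMap.id ℝ (Eucl N))) t :=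
    (hρ (x - t)).hasFDerivAt.comp t ((hasFDerivAt_id t).const_sub x)
  rw [partialDeriv, h1.fderiv]
  simp [partialDeriv]

theorem partialDeriv_convolution {ρ f : Eucl N → ℝ} (hc : HasCompactSupport ρ)
    (hρ : ContDiff ℝ 1 ρ) (hf : LocallyIntegrable f) (i : Fin N) (x : Eucl N) :
    partialDeriv (convolution ρ f (ContinuousLinearMap.lsmul ℝ ℝ) volume) i x =
      ∫ t, partialDeriv ρ i t * f (x - t) := by
  have hd := hc.hasFDerivAt_convolution_left (ContinuousLinearMap.lsmul ℝ ℝ) hρ hf x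
  have hci := (hc.fderiv (𝕜 := ℝ)).convolutionExists_left
    (ContinuousLinearMap.precompL (Eucl N) (ContinuousLinearMap.lsmul ℝ ℝ))
    (hρ.continuous_fderiv one_ne_zero) hf x
  unfold partialDeriv
  rw [hd.fderiv, convolution_def, ContinuousLinearMap.integral_apply hci]
  rfl

/-- Away from the boundary of `Ω`, mollification turns weak derivatives into classical ones. -/
theorem partialDeriv_mollify (φ : ContDiffBump (0 : Eucl N)) {Ω : Opens (Eucl N)}
    {f g : Eucl N → ℝ} {i : Fin N} (hf : LocallyIntegrable (zeroExt Ω f))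
    (hfg : HasWeakPartialDeriv Ω i f g) {x : Eucl N} (hx : Metric.closedBall x φ.rOut ⊆ Ω) :
    partialDeriv (mollify φ (zeroExt Ω f)) i x = mollify φ (zeroExt Ω g) x := by
  have hc1 : ContDiff ℝ 1 (φ.normed (volume : Measure (Eucl N))) := φ.contDiff_normed
  have e2 : ∫ t, partialDeriv (φ.normed volume) i t * zeroExt Ω f (x - t) =
      ∫ t, f t * partialDeriv (φ.normed volume) i (x - t) ∂(lebesgueOn Ω) := by
    rw [← integral_sub_left_eq_self _ volume x, ← integral_indicator Ω.isOpen.measurableSet]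
    refine integral_congr_ae (Eventually.of_forall fun y => ?_)
    by_cases hy : y ∈ (Ω : Set (Eucl N)) <;> simp [zeroExt, hy, mul_comm]
  have h := hfg (bumpTest φ x hx)
  rw [bumpTest_apply] at h
  simp only [partialDeriv_comp_sub_left (hc1.differentiable one_ne_zero), mul_neg, integral_neg,
    neg_inj] at h
  rw [mollify_zeroExt, ← h, ← e2]
  exact partialDeriv_convolution φ.hasCompactSupport_normed hc1 hf i x

/-- `f ∈ L^p(Ω)` has the weak gradient `g ∈ L^p(Ω)^N`; the representatives are Borel functions. -/
structure IsW1 (Ω : Opens (Eucl N)) (p : ℝ≥0∞) (f : Eucl N → ℝ) (g : Fin N → Eucl N → ℝ) :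
    Prop where
  measurable : Measurable f
  measurable_grad : ∀ i, Measurable (g i)
  memLp : MemLp f p (lebesgueOn Ω)
  memLp_grad : ∀ i, MemLp (g i) p (lebesgueOn Ω)
  weak : ∀ i, HasWeakPartialDeriv Ω i f (g i)

theorem integrable_mul_of_memLp {Ω : Opens (Eucl N)} {p : ℝ≥0∞} (hp : 1 ≤ p) {f : Eucl N → ℝ}
    (hf : MemLp f p (lebesgueOn Ω)) {ψ : Eucl N → ℝ} (hc : Continuous ψ)
    (hs : HasCompactSupport ψ) : Integrable (fun x => f x * ψ x) (lebesgueOn Ω) := by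
  simpa [mul_comm] using
    (hf.locallyIntegrable hp).integrable_smul_left_of_hasCompactSupport hc hs

theorem IsW1.sub {Ω : Opens (Eucl N)} {p : ℝ≥0∞} (hp : 1 ≤ p) {f f' : Eucl N → ℝ}
    {g g' : Fin N → Eucl N → ℝ} (h : IsW1 Ω p f g) (h' : IsW1 Ω p f' g') :
    IsW1 Ω p (fun x => f x - f' x) (fun i x => g i x - g' i x) where
  measurable := h.measurable.sub h'.measurable
  measurable_grad i := (h.measurable_grad i).sub (h'.measurable_grad i)
  memLp := h.memLp.sub h'.memLp
  memLp_grad i := (h.memLp_grad i).sub (h'.memLp_grad i)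
  weak i := by
    intro φ
    have hφ : Continuous (φ : Eucl N → ℝ) := (TestFunctionClass.map_contDiff φ).continuous
    have hφs := TestFunctionClass.map_hasCompactSupport φ
    simp only [sub_mul]
    rw [integral_sub (integrable_mul_of_memLp hp h.memLp (continuous_partialDeriv φ i)
        (hasCompactSupport_partialDeriv φ i))
      (integrable_mul_of_memLp hp h'.memLp (continuous_partialDeriv φ i)
        (hasCompactSupport_partialDeriv φ i)),
      integral_sub (integrable_mul_of_memLp hp (h.memLp_grad i) hφ hφs)
        (integrable_mul_of_memLp hp (h'.memLp_grad i) hφ hφs), h.weak i φ, h'.weak i φ]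
    ring

theorem fderiv_apply_eq_sum (f : Eucl N → ℝ) (x y : Eucl N) :
    fderiv ℝ f x y = ∑ i, y i * partialDeriv f i x := by
  conv_lhs => rw [← (EuclideanSpace.basisFun (Fin N) ℝ).sum_repr y]
  simp [partialDeriv]

/-- The fundamental theorem of calculus bounds the oscillation of a smooth function under small
translations by its gradient. -/
theorem eLpNorm_comp_sub_sub_le_of_contDiff {f : Eucl N → ℝ} (hf : ContDiff ℝ (⊤ : ℕ∞) f)
    {p : ℝ≥0∞} (hp1 : 1 ≤ p) (hp : p ≠ ⊤) {K U : Set (Eucl N)} (hK : MeasurableSet K)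
    (hU : MeasurableSet U) {r : ℝ} (hKU : ∀ x ∈ K, Metric.closedBall x r ⊆ U) {y : Eucl N}
    (hy : ‖y‖ ≤ r) :
    eLpNorm (fun x => f (x - y) - f x) p (volume.restrict K) ≤
      ENNReal.ofReal r * ∑ i, eLpNorm (partialDeriv f i) p (volume.restrict U) := by
  set F : ℝ → Eucl N → ℝ := fun t x => ∑ i, (-y i) * partialDeriv f i (x - t • y) with hF
  have hcont : Continuous (Function.uncurry F) := by
    have : ∀ i, Continuous (partialDeriv f i) := fun i => (contDiff_partialDeriv hf i).continuous
    simp only [hF, Function.uncurry_def]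
    fun_prop
  set ν : Measure ℝ := volume.restrict (Set.Ioc 0 1) with hν
  have : IsProbabilityMeasure ν := ⟨by simp [hν]⟩
  have e : (fun x => f (x - y) - f x) = fun x => ∫ t, F t x ∂ν := by
    funext x
    have hd : ∀ t : ℝ, HasDerivAt (fun t : ℝ => f (x - t • y)) (F t x) t := by
      intro t
      have h1 : HasDerivAt (fun t : ℝ => x - t • y) (-((1 : ℝ) • y)) t :=
        ((hasDerivAt_id t).smul_const y).const_sub x
      have h2 := ((hf.differentiable (by simp)) (x - t • y)).hasFDerivAt.comp_hasDerivAt t h1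
      have h3 : F t x = fderiv ℝ f (x - t • y) (-((1 : ℝ) • y)) := by
        rw [fderiv_apply_eq_sum]
        simp [hF]
      rw [h3]
      exact h2
    have h3 := intervalIntegral.integral_eq_sub_of_hasDerivAt (a := 0) (b := 1)
      (fun t _ => hd t) ((hcont.comp (by fun_prop : Continuous fun t : ℝ => (t, x))).intervalIntegrable
        0 1)
    rw [intervalIntegral.integral_of_le zero_le_one] at h3
    rw [hν, h3]
    simp
  rw [e]
  refine eLpNorm_integral_le_of_ae_le hcont.measurable hp1 hp ?_
  rw [hν]
  refine (ae_restrict_iff' measurableSet_Ioc).2 (Eventually.of_forall fun t ht => ?_)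
  have hsum : F t = ∑ i, ((-y i) • fun x => partialDeriv f i (x - t • y)) := by
    funext x; simp [hF]
  have hmeas : ∀ i, AEStronglyMeasurable (fun x => partialDeriv f i (x - t • y))
      (volume.restrict K) := fun i =>
    ((contDiff_partialDeriv hf i).continuous.comp (by fun_prop)).aestronglyMeasurable
  rw [hsum, Finset.mul_sum]
  refine (eLpNorm_sum_le (fun i _ => (hmeas i).const_smul _) hp1).trans
    (Finset.sum_le_sum fun i _ => ?_)
  rw [eLpNorm_const_smul]
  gcongr
  · rw [← ofReal_norm, norm_neg]
    exact ENNReal.ofReal_le_ofReal ((PiLp.norm_apply_le y i).trans hy)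
  · calc eLpNorm (fun x => partialDeriv f i (x - t • y)) p (volume.restrict K)
        = eLpNorm (fun x => U.indicator (partialDeriv f i) (x - t • y)) p (volume.restrict K) := by
          refine eLpNorm_congr_ae ((ae_restrict_iff' hK).2 (Eventually.of_forall fun x hx => ?_))
          have : x - t • y ∈ U := by
            refine hKU x hx ?_
            rw [Metric.mem_closedBall, dist_eq_norm, sub_sub_cancel_left, norm_neg, norm_smul,
              Real.norm_eq_abs, abs_of_pos ht.1]
            nlinarith [norm_nonneg y, ht.2, ht.1]
          simp [this]
      _ ≤ eLpNorm (fun x => U.indicator (partialDeriv f i) (x - t • y)) p volume :=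
          eLpNorm_mono_measure _ Measure.restrict_le_self
      _ = eLpNorm (U.indicator (partialDeriv f i)) p volume :=
          eLpNorm_comp_sub ((contDiff_partialDeriv hf i).continuous.measurable.indicator hU) _
      _ = _ := eLpNorm_indicator_eq_eLpNorm_restrict hU

theorem IsW1.locallyIntegrable_zeroExt {Ω : Opens (Eucl N)} {p : ℝ≥0∞} (hp : 1 ≤ p)
    {f : Eucl N → ℝ} {g : Fin N → Eucl N → ℝ} (h : IsW1 Ω p f g) :
    LocallyIntegrable (zeroExt Ω f) :=
  (memLp_zeroExt h.memLp).locallyIntegrable hp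

/-- The estimate for smooth functions, applied to mollifications of `f`. The distance `3r` to the
boundary leaves room for the translation and for a mollification radius of at most `r`. -/
theorem IsW1.eLpNorm_comp_sub_sub_le {Ω : Opens (Eucl N)} {p : ℝ≥0∞} (hp1 : 1 ≤ p) (hp : p ≠ ⊤)
    {f : Eucl N → ℝ} {g : Fin N → Eucl N → ℝ} (h : IsW1 Ω p f g) {K : Set (Eucl N)}
    (hK : MeasurableSet K) {r : ℝ} (hr : 0 < r)
    (hKΩ : ∀ x ∈ K, Metric.closedBall x (3 * r) ⊆ Ω) {y : Eucl N} (hy : ‖y‖ ≤ r) :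
    eLpNorm (fun x => zeroExt Ω f (x - y) - zeroExt Ω f x) p (volume.restrict K) ≤
      ENNReal.ofReal r * ∑ i, eLpNorm (g i) p (lebesgueOn Ω) := by
  set f₀ := zeroExt Ω f with hf₀
  have hm : Measurable f₀ := measurable_zeroExt h.measurable
  have hloc : LocallyIntegrable f₀ := h.locallyIntegrable_zeroExt hp1
  set v : ℕ → Eucl N → ℝ := fun n => mollify (bumpSeq N n) f₀ with hv
  have hvs : ∀ n, ContDiff ℝ (⊤ : ℕ∞) (v n) := fun n => contDiff_mollify _ hloc
  set d : ℕ → ℝ≥0∞ := fun n => eLpNorm (fun x => v n x - f₀ x) p volume with hd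
  have hdlim : Tendsto d atTop (𝓝 0) := tendsto_eLpNorm_mollify_sub hp1 hp (memLp_zeroExt h.memLp) hm
  set U := Metric.thickening (2 * r) K with hU
  have hUm : MeasurableSet U := Metric.isOpen_thickening.measurableSet
  have hKU : ∀ x ∈ K, Metric.closedBall x r ⊆ U := fun x hx z hz =>
    Metric.mem_thickening_iff.2 ⟨x, hx, lt_of_le_of_lt hz (by linarith)⟩
  have hUΩ : ∀ z ∈ U, Metric.closedBall z r ⊆ Ω := by
    intro z hz
    obtain ⟨x, hx, hzx⟩ := Metric.mem_thickening_iff.1 hz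
    exact (Metric.closedBall_subset_closedBall' (by linarith)).trans (hKΩ x hx)
  have hbound : ∀ᶠ n in atTop, eLpNorm (fun x => f₀ (x - y) - f₀ x) p (volume.restrict K) ≤
      d n + (ENNReal.ofReal r * ∑ i, eLpNorm (g i) p (lebesgueOn Ω)) + d n := by
    filter_upwards [(tendsto_bumpSeq_rOut N).eventually (ge_mem_nhds hr)] with n hn
    have e : (fun x => f₀ (x - y) - f₀ x) = (fun x => (-(1 : ℝ)) • (v n (x - y) - f₀ (x - y))) +
        (fun x => v n (x - y) - v n x) + fun x => v n x - f₀ x := by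
      funext x; simp
    have hmv : Measurable (v n) := (hvs n).continuous.measurable
    have hm1 : Measurable fun x => v n x - f₀ x := hmv.sub hm
    have hm1' : Measurable fun x => (-(1 : ℝ)) • (v n (x - y) - f₀ (x - y)) :=
      ((hmv.comp (measurable_id.sub_const y)).sub (hm.comp (measurable_id.sub_const y))).const_smul
        (-(1 : ℝ))
    have hm2 : Measurable fun x => v n (x - y) - v n x :=
      (hmv.comp (measurable_id.sub_const y)).sub hmv
    rw [e]
    refine (eLpNorm_add_le (hm1'.add hm2).aestronglyMeasurable hm1.aestronglyMeasurable hp1).trans ?_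
    gcongr
    · refine (eLpNorm_add_le hm1'.aestronglyMeasurable hm2.aestronglyMeasurable hp1).trans ?_
      gcongr
      · have e2 : (fun x => (-(1 : ℝ)) • (v n (x - y) - f₀ (x - y))) =
          (-(1 : ℝ)) • fun x => v n (x - y) - f₀ (x - y) := rfl
        rw [e2, eLpNorm_const_smul]
        simp only [enorm_neg, enorm_one, one_mul]
        exact (eLpNorm_mono_measure _ Measure.restrict_le_self).trans (eLpNorm_comp_sub hm1 y).le
      · refine (eLpNorm_comp_sub_sub_le_of_contDiff (hvs n) hp1 hp hK hUm hKU hy).trans ?_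
        gcongr with i _
        calc eLpNorm (partialDeriv (v n) i) p (volume.restrict U)
            = eLpNorm (mollify (bumpSeq N n) (zeroExt Ω (g i))) p (volume.restrict U) := by
              refine eLpNorm_congr_ae ((ae_restrict_iff' hUm).2
                (Eventually.of_forall fun x hx => ?_))
              exact partialDeriv_mollify _ hloc (h.weak i)
                ((Metric.closedBall_subset_closedBall hn).trans (hUΩ x hx))
          _ ≤ eLpNorm (mollify (bumpSeq N n) (zeroExt Ω (g i))) p volume :=
              eLpNorm_mono_measure _ Measure.restrict_le_self
          _ ≤ eLpNorm (zeroExt Ω (g i)) p volume :=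
              eLpNorm_mollify_le _ (measurable_zeroExt (h.measurable_grad i)) hp1 hp
          _ = _ := eLpNorm_zeroExt
    · exact eLpNorm_mono_measure _ Measure.restrict_le_self
  have hlim : Tendsto (fun n => d n + (ENNReal.ofReal r * ∑ i, eLpNorm (g i) p (lebesgueOn Ω)) + d n)
      atTop (𝓝 (0 + (ENNReal.ofReal r * ∑ i, eLpNorm (g i) p (lebesgueOn Ω)) + 0)) :=
    (hdlim.add tendsto_const_nhds).add hdlim
  rw [zero_add, add_zero] at hlim
  exact ge_of_tendsto hlim hbound

theorem IsW1.eLpNorm_mollify_sub_le {Ω : Opens (Eucl N)} {p : ℝ≥0∞} (hp1 : 1 ≤ p) (hp : p ≠ ⊤)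
    {f : Eucl N → ℝ} {g : Fin N → Eucl N → ℝ} (h : IsW1 Ω p f g) {K : Set (Eucl N)}
    (hK : MeasurableSet K) {r : ℝ} (hr : 0 < r)
    (hKΩ : ∀ x ∈ K, Metric.closedBall x (3 * r) ⊆ Ω) :
    eLpNorm (fun x => mollify (bump N r hr) (zeroExt Ω f) x - zeroExt Ω f x) p
      (volume.restrict K) ≤ ENNReal.ofReal r * ∑ i, eLpNorm (g i) p (lebesgueOn Ω) :=
  HessianMinors.eLpNorm_mollify_sub_le _ (h.locallyIntegrable_zeroExt hp1)
    (measurable_zeroExt h.measurable) hp1 hp fun y hy =>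
      h.eLpNorm_comp_sub_sub_le hp1 hp hK hr hKΩ (by
        rw [Metric.mem_ball, dist_zero_right] at hy
        exact hy.le)

/-! ### Local strong convergence -/

theorem isFiniteMeasure_lebesgueOn {Ω : Opens (Eucl N)}
    (hΩ : Bornology.IsBounded (Ω : Set (Eucl N))) : IsFiniteMeasure (lebesgueOn Ω) :=
  ⟨by simpa using hΩ.measure_lt_top⟩

theorem exists_closedBall_subset {Ω : Opens (Eucl N)} {K : Set (Eucl N)} (hK : IsCompact K)
    (hKΩ : K ⊆ Ω) : ∃ r > 0, ∀ x ∈ K, Metric.closedBall x r ⊆ Ω := by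
  obtain ⟨δ, hδ, h⟩ := hK.exists_cthickening_subset_open Ω.isOpen hKΩ
  exact ⟨δ, hδ, fun x hx => (Metric.closedBall_subset_cthickening hx δ).trans h⟩

/-- If `f_n → 0` weakly in `L^p(Ω)`, a fixed mollification of `f_n` tends to zero pointwise and stays
bounded, so it tends to zero in `L^p`. -/
theorem tendsto_eLpNorm_mollify_zero {Ω : Opens (Eucl N)}
    (hΩ : Bornology.IsBounded (Ω : Set (Eucl N))) {p : ℝ≥0∞} (hp1 : 1 ≤ p) (hp : p ≠ ⊤)
    {f : ℕ → Eucl N → ℝ} (hf : ∀ n, MemLp (f n) p (lebesgueOn Ω)) {C : ℝ≥0∞} (hC : C ≠ ⊤)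
    (hb : ∀ n, eLpNorm (f n) p (lebesgueOn Ω) ≤ C)
    (hw : ∀ ψ : Eucl N → ℝ, Continuous ψ → HasCompactSupport ψ →
      Tendsto (fun n => ∫ x, f n x * ψ x ∂(lebesgueOn Ω)) atTop (𝓝 0))
    (φ : ContDiffBump (0 : Eucl N)) {K : Set (Eucl N)} (hK : IsCompact K) :
    Tendsto (fun n => eLpNorm (mollify φ (zeroExt Ω (f n))) p (volume.restrict K)) atTop (𝓝 0) := by
  have := isFiniteMeasure_lebesgueOn hΩ
  have hp0 : p ≠ 0 := (one_pos.trans_le hp1).ne'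
  have hpr : 0 < p.toReal := ENNReal.toReal_pos hp0 hp
  set ρ := φ.normed (volume : Measure (Eucl N)) with hρ
  have hρc : HasCompactSupport ρ := φ.hasCompactSupport_normed
  obtain ⟨M, hM⟩ := φ.continuous_normed.bounded_above_of_compact_support hρc
  have hpt : ∀ x, Tendsto (fun n => mollify φ (zeroExt Ω (f n)) x) atTop (𝓝 0) := by
    intro x
    simp only [mollify_zeroExt]
    refine hw (fun y => ρ (x - y)) (φ.continuous_normed.comp (by fun_prop)) ?_
    exact hρc.comp_homeomorph (Homeomorph.subLeft x)
  obtain ⟨c, hc, hcb⟩ := exists_eLpNorm_le_mul (lebesgueOn Ω) le_rfl hp1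
  set D : ℝ≥0∞ := ENNReal.ofReal M * (c * C) with hD
  have hDtop : D ≠ ⊤ := ENNReal.mul_ne_top ENNReal.ofReal_ne_top (ENNReal.mul_ne_top hc hC)
  have hbd : ∀ n x, ‖mollify φ (zeroExt Ω (f n)) x‖ₑ ≤ D := by
    intro n x
    rw [mollify_zeroExt]
    calc ‖∫ y, f n y * ρ (x - y) ∂(lebesgueOn Ω)‖ₑ
        ≤ ∫⁻ y, ‖f n y * ρ (x - y)‖ₑ ∂(lebesgueOn Ω) := enorm_integral_le_lintegral_enorm _
      _ ≤ ∫⁻ y, ENNReal.ofReal M * ‖f n y‖ₑ ∂(lebesgueOn Ω) := by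
          refine lintegral_mono fun y => ?_
          rw [enorm_mul, mul_comm]
          gcongr
          rw [← ofReal_norm]
          exact ENNReal.ofReal_le_ofReal (hM _)
      _ = ENNReal.ofReal M * eLpNorm (f n) 1 (lebesgueOn Ω) := by
          rw [lintegral_const_mul' _ _ ENNReal.ofReal_ne_top, eLpNorm_one_eq_lintegral_enorm]
      _ ≤ D := by
          rw [hD]
          gcongr
          refine (hcb _ (hf n).1).trans ?_
          gcongr
          exact hb n
  have hmeas : ∀ n, Measurable (mollify φ (zeroExt Ω (f n))) := fun n =>
    (contDiff_mollify φ ((memLp_zeroExt (hf n)).locallyIntegrable hp1)).continuous.measurable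
  have hlim : Tendsto (fun n => ∫⁻ x in K, ‖mollify φ (zeroExt Ω (f n)) x‖ₑ ^ p.toReal) atTop
      (𝓝 (∫⁻ _ in K, 0)) := by
    refine tendsto_lintegral_of_dominated_convergence (fun _ => D ^ p.toReal)
      (fun n => ((hmeas n).enorm.pow_const _)) (fun n => Eventually.of_forall fun x => ?_) ?_
      (Eventually.of_forall fun x => ?_)
    · exact ENNReal.rpow_le_rpow (hbd n x) hpr.le
    · rw [lintegral_const]
      refine ENNReal.mul_ne_top (ENNReal.rpow_ne_top_of_nonneg hpr.le hDtop) ?_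
      simpa using hK.measure_lt_top.ne
    · have h1 : Tendsto (fun n => ‖mollify φ (zeroExt Ω (f n)) x‖ₑ) atTop (𝓝 0) := by
        simpa using (hpt x).enorm
      have h2 := (ENNReal.continuous_rpow_const (y := p.toReal)).tendsto 0 |>.comp h1
      rwa [ENNReal.zero_rpow_of_pos hpr] at h2
  have h3 := (ENNReal.continuous_rpow_const (y := 1 / p.toReal)).tendsto 0
  rw [ENNReal.zero_rpow_of_pos (by positivity)] at h3
  rw [lintegral_zero] at hlim
  refine (h3.comp hlim).congr fun n => ?_
  rw [eLpNorm_eq_lintegral_rpow_enorm_toReal hp0 hp]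
  rfl

theorem zeroExt_ae_eq {Ω : Opens (Eucl N)} {K : Set (Eucl N)} (hK : MeasurableSet K)
    (hKΩ : K ⊆ Ω) (f : Eucl N → ℝ) : zeroExt Ω f =ᵐ[volume.restrict K] f :=
  (ae_restrict_iff' hK).2 (Eventually.of_forall fun x hx => by
    have : x ∈ (Ω : Set (Eucl N)) := hKΩ hx
    simp only [zeroExt, Set.indicator_of_mem this])

/-- The Rellich–Kondrachov theorem on compact subsets of `Ω`, for a bounded sequence in `W^{1,p}(Ω)`
that tends weakly to zero: on `K` the functions are within `O(r)` of their mollifications of radius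
`r`, uniformly in `n`, and these tend to zero for fixed `r`. -/
theorem tendsto_eLpNorm_zero_of_weak {Ω : Opens (Eucl N)}
    (hΩ : Bornology.IsBounded (Ω : Set (Eucl N))) {p : ℝ≥0∞} (hp1 : 1 ≤ p) (hp : p ≠ ⊤)
    {f : ℕ → Eucl N → ℝ} {g : ℕ → Fin N → Eucl N → ℝ} (h : ∀ n, IsW1 Ω p (f n) (g n))
    {C : ℝ≥0∞} (hC : C ≠ ⊤) (hb : ∀ n, eLpNorm (f n) p (lebesgueOn Ω) ≤ C)
    (hbg : ∀ n i, eLpNorm (g n i) p (lebesgueOn Ω) ≤ C)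
    (hw : ∀ ψ : Eucl N → ℝ, Continuous ψ → HasCompactSupport ψ →
      Tendsto (fun n => ∫ x, f n x * ψ x ∂(lebesgueOn Ω)) atTop (𝓝 0))
    {K : Set (Eucl N)} (hK : IsCompact K) (hKΩ : K ⊆ Ω) :
    Tendsto (fun n => eLpNorm (f n) p (volume.restrict K)) atTop (𝓝 0) := by
  rw [ENNReal.tendsto_nhds_zero]
  intro ε hε
  obtain ⟨r₀, hr₀, hball⟩ := exists_closedBall_subset hK hKΩ
  -- The radius `r` is small compared to the distance from `K` to the boundary and to `ε / C`.
  obtain ⟨r, hr, hr3, hrε⟩ : ∃ r : ℝ, 0 < r ∧ 3 * r ≤ r₀ ∧ ENNReal.ofReal r * (N * C) ≤ ε / 2 := by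
    have hlim : Tendsto (fun r : ℝ => ENNReal.ofReal r * (N * C)) (𝓝 0) (𝓝 0) := by
      have := ENNReal.Tendsto.mul_const (b := (N * C : ℝ≥0∞))
        (ENNReal.tendsto_ofReal (tendsto_id (α := ℝ) (x := 𝓝 0)))
        (Or.inr (ENNReal.mul_ne_top (ENNReal.natCast_ne_top N) hC))
      simpa using this
    have h1 := ENNReal.tendsto_nhds_zero.1 hlim (ε / 2) (ENNReal.half_pos hε.ne')
    obtain ⟨δ, hδ, hδb⟩ := Metric.eventually_nhds_iff.1 h1
    refine ⟨min (δ / 2) (r₀ / 3), by positivity, ?_, hδb ?_⟩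
    · linarith [min_le_right (δ / 2) (r₀ / 3)]
    · rw [Real.dist_0_eq_abs, abs_of_pos (by positivity)]
      linarith [min_le_left (δ / 2) (r₀ / 3)]
  have h2 := ENNReal.tendsto_nhds_zero.1
    (tendsto_eLpNorm_mollify_zero hΩ hp1 hp (fun n => (h n).memLp) hC hb hw (bump N r hr) hK)
    (ε / 2) (ENNReal.half_pos hε.ne')
  filter_upwards [h2] with n hn
  set v := mollify (bump N r hr) (zeroExt Ω (f n)) with hv
  have hvm : Measurable v :=
    (contDiff_mollify _ ((h n).locallyIntegrable_zeroExt hp1)).continuous.measurable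
  have hfm : Measurable (zeroExt Ω (f n)) := measurable_zeroExt (h n).measurable
  rw [← eLpNorm_congr_ae (zeroExt_ae_eq hK.measurableSet hKΩ (f n))]
  have e : zeroExt Ω (f n) = v - fun x => v x - zeroExt Ω (f n) x := by
    funext x; simp
  rw [e]
  refine (eLpNorm_sub_le hvm.aestronglyMeasurable (hvm.sub hfm).aestronglyMeasurable hp1).trans ?_
  rw [← ENNReal.add_halves ε]
  gcongr
  refine ((h n).eLpNorm_mollify_sub_le hp1 hp hK.measurableSet hr fun x hx =>
    (Metric.closedBall_subset_closedBall hr3).trans (hball x hx)).trans ?_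
  refine le_trans ?_ hrε
  gcongr
  refine (Finset.sum_le_sum fun i _ => hbg n i).trans ?_
  simp

/-! ### Integration by parts for weakly differentiable functions -/

/-- The matrix with entries `g_{a, c b}`, to be thought of as `∂f_a/∂x_{c b}`. -/
def gradMatrix (c : Fin k → Fin N) (g : Fin k → Fin N → Eucl N → ℝ) (x : Eucl N) :
    Matrix (Fin k) (Fin k) ℝ :=
  fun a b => g a (c b) x

/-- Integrals of determinants of order `k` are continuous in the entries for the norm of `L^k`. -/
theorem tendsto_integral_det {ι : Type*} {l : Filter ι} {μ : Measure (Eucl N)} (hk : 1 ≤ k)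
    {A : ι → Eucl N → Matrix (Fin k) (Fin k) ℝ} {B : Eucl N → Matrix (Fin k) (Fin k) ℝ}
    (hA : ∀ n a b, MemLp (fun x => A n x a b) k μ) (hB : ∀ a b, MemLp (fun x => B x a b) k μ)
    (h : ∀ a b, Tendsto (fun n => eLpNorm (fun x => A n x a b - B x a b) k μ) l (𝓝 0)) :
    Tendsto (fun n => ∫ x, (A n x).det ∂μ) l (𝓝 (∫ x, (B x).det ∂μ)) := by
  have hint : ∀ {D : Eucl N → Matrix (Fin k) (Fin k) ℝ},
      (∀ a b, MemLp (fun x => D x a b) k μ) → Integrable (fun x => (D x).det) μ := fun hD =>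
    memLp_one_iff_integrable.1 (memLp_det hk le_rfl (by simpa using hD))
  exact tendsto_integral_of_L1' _ (hint hB).1 (Eventually.of_forall fun n => hint (hA n))
    (tendsto_eLpNorm_det_sub_det hk (fun n a b => (hA n a b).1) hB h)

theorem tendsto_eLpNorm_mul_sub {X ι : Type*} [MeasurableSpace X] {μ : Measure X} {l : Filter ι}
    {p : ℝ≥0∞} {h : ι → X → ℝ} {h₀ ψ : X → ℝ} {M : ℝ} (hM : ∀ x, ‖ψ x‖ ≤ M)
    (hh : Tendsto (fun n => eLpNorm (fun x => h n x - h₀ x) p μ) l (𝓝 0)) :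
    Tendsto (fun n => eLpNorm (fun x => ψ x * h n x - ψ x * h₀ x) p μ) l (𝓝 0) := by
  have h1 := ENNReal.Tendsto.const_mul hh (a := ENNReal.ofReal M) (Or.inr ENNReal.ofReal_ne_top)
  rw [mul_zero] at h1
  refine tendsto_of_tendsto_of_tendsto_of_le_of_le tendsto_const_nhds h1 (fun _ => zero_le)
    fun n => eLpNorm_le_mul_eLpNorm_of_ae_le_mul (Eventually.of_forall fun x => ?_) p
  rw [← mul_sub, norm_mul]
  exact mul_le_mul_of_nonneg_right (hM x) (norm_nonneg _)

theorem memLp_restrict_of_continuous {K : Set (Eucl N)} (hK : IsCompact K) {f : Eucl N → ℝ}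
    (hf : Continuous f) (p : ℝ≥0∞) : MemLp f p (volume.restrict K) := by
  have : IsFiniteMeasure (volume.restrict K) := ⟨by simpa using hK.measure_lt_top⟩
  obtain ⟨C, hC⟩ := hK.exists_bound_of_continuousOn hf.continuousOn
  exact MemLp.of_bound hf.aestronglyMeasurable C
    ((ae_restrict_iff' hK.measurableSet).2 (Eventually.of_forall hC))

theorem memLp_mul_of_bound {X : Type*} [MeasurableSpace X] {μ : Measure X} {p : ℝ≥0∞}
    {f ψ : X → ℝ} (hf : MemLp f p μ) (hψ : AEStronglyMeasurable ψ μ) {M : ℝ}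
    (hM : ∀ x, ‖ψ x‖ ≤ M) : MemLp (fun x => ψ x * f x) p μ :=
  hf.of_le_mul (c := M) (hψ.mul hf.1) (Eventually.of_forall fun x => by
    rw [norm_mul]; exact mul_le_mul_of_nonneg_right (hM x) (norm_nonneg _))

theorem memLp_restrict_of_subset {Ω : Opens (Eucl N)} {K : Set (Eucl N)} (hKΩ : K ⊆ Ω)
    {p : ℝ≥0∞} {f : Eucl N → ℝ} (hf : MemLp f p (lebesgueOn Ω)) :
    MemLp f p (volume.restrict K) :=
  hf.mono_measure (Measure.restrict_mono_set _ hKΩ)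

theorem integral_lebesgueOn_eq_setIntegral {Ω : Opens (Eucl N)} {K : Set (Eucl N)}
    (hKΩ : K ⊆ Ω) {f : Eucl N → ℝ} (hf : ∀ x ∉ K, f x = 0) :
    ∫ x, f x ∂(lebesgueOn Ω) = ∫ x in K, f x :=
  setIntegral_eq_of_subset_of_forall_sdiff_eq_zero Ω.isOpen.measurableSet hKΩ
    fun x hx => hf x hx.2

theorem det_updateRow_smul_self (M : Matrix (Fin k) (Fin k) ℝ) (i : Fin k) (t : ℝ) :
    (M.updateRow i (t • M i)).det = t * M.det := by
  rw [Matrix.det_updateRow_smul, Matrix.updateRow_eq_self]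

/-- Convergence of the determinants of `A_n`, with one row multiplied by a fixed bounded function. -/
theorem tendsto_integral_det_updateRow {ι : Type*} {l : Filter ι} {μ : Measure (Eucl N)}
    (hk : 1 ≤ k) {A : ι → Eucl N → Matrix (Fin k) (Fin k) ℝ}
    {B : Eucl N → Matrix (Fin k) (Fin k) ℝ}
    (hA : ∀ n a b, MemLp (fun x => A n x a b) k μ) (hB : ∀ a b, MemLp (fun x => B x a b) k μ)
    (h : ∀ a b, Tendsto (fun n => eLpNorm (fun x => A n x a b - B x a b) k μ) l (𝓝 0))
    (i : Fin k) {s : ι → Fin k → Eucl N → ℝ} {s₀ : Fin k → Eucl N → ℝ}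
    (hs : ∀ n b, MemLp (s n b) k μ) (hs₀ : ∀ b, MemLp (s₀ b) k μ)
    (hlim : ∀ b, Tendsto (fun n => eLpNorm (fun x => s n b x - s₀ b x) k μ) l (𝓝 0)) :
    Tendsto (fun n => ∫ x, ((A n x).updateRow i fun b => s n b x).det ∂μ) l
      (𝓝 (∫ x, ((B x).updateRow i fun b => s₀ b x).det ∂μ)) := by
  refine tendsto_integral_det hk (fun n a b => ?_) (fun a b => ?_) fun a b => ?_
  · by_cases hai : a = i
    · subst hai; simpa using hs n b
    · simpa [Matrix.updateRow_ne hai] using hA n a b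
  · by_cases hai : a = i
    · subst hai; simpa using hs₀ b
    · simpa [Matrix.updateRow_ne hai] using hB a b
  · by_cases hai : a = i
    · subst hai; simpa using hlim b
    · simpa [Matrix.updateRow_ne hai] using h a b

/-- Integration by parts for Jacobian determinants of functions in `W^{1,k}(Ω)`: the weight `φ`
changes places with the function in the row `i`. -/
theorem integral_mul_det_gradMatrix (hk : 1 ≤ k) (c : Fin k → Fin N) {Ω : Opens (Eucl N)}
    {f : Fin k → Eucl N → ℝ} {g : Fin k → Fin N → Eucl N → ℝ}
    (h : ∀ a, IsW1 Ω k (f a) (g a)) (φ : TestFunction Ω ℝ (⊤ : ℕ∞)) (i : Fin k) :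
    ∫ x, φ x * (gradMatrix c g x).det ∂(lebesgueOn Ω) =
      - ∫ x, ((gradMatrix c g x).updateRow i fun b => f i x * partialDeriv φ (c b) x).det
        ∂(lebesgueOn Ω) := by
  have hk1 : (1 : ℝ≥0∞) ≤ k := Nat.one_le_cast.2 hk
  have hkt : (k : ℝ≥0∞) ≠ ⊤ := ENNReal.natCast_ne_top k
  set K := tsupport (φ : Eucl N → ℝ) with hKdef
  have hφs : ContDiff ℝ (⊤ : ℕ∞) (φ : Eucl N → ℝ) := TestFunctionClass.map_contDiff φ
  have hφc : HasCompactSupport (φ : Eucl N → ℝ) := TestFunctionClass.map_hasCompactSupport φ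
  have hK : IsCompact K := hφc
  have hKm : MeasurableSet K := hK.measurableSet
  have hKΩ : K ⊆ Ω := TestFunctionClass.tsupport_map_subset φ
  have hφ0 : ∀ x ∉ K, φ x = 0 := fun x hx => image_eq_zero_of_notMem_tsupport hx
  obtain ⟨M, hM⟩ := hφs.continuous.bounded_above_of_compact_support hφc
  obtain ⟨r, hr, hball⟩ := exists_closedBall_subset hK hKΩ
  -- The identity holds for the mollifications `v n` of the `f a`, and both sides converge; on the
  -- support `K` of `φ` the gradients of the `v n` are the mollified weak gradients.
  set v : ℕ → Fin k → Eucl N → ℝ := fun n a => mollify (bumpSeq N n) (zeroExt Ω (f a)) with hv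
  have hloc : ∀ a, LocallyIntegrable (zeroExt Ω (f a)) := fun a =>
    (h a).locallyIntegrable_zeroExt hk1
  have hvs : ∀ n a, ContDiff ℝ (⊤ : ℕ∞) (v n a) := fun n a => contDiff_mollify _ (hloc a)
  have hrestr : ∀ {f₀ : Eucl N → ℝ}, MemLp f₀ k (lebesgueOn Ω) → Measurable f₀ →
      Tendsto (fun n => eLpNorm (fun x => mollify (bumpSeq N n) (zeroExt Ω f₀) x - f₀ x) k
        (volume.restrict K)) atTop (𝓝 0) := by
    intro f₀ hf₀ hm
    refine tendsto_of_tendsto_of_tendsto_of_le_of_le tendsto_const_nhds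
      (tendsto_eLpNorm_mollify_sub hk1 hkt (memLp_zeroExt hf₀) (measurable_zeroExt hm))
      (fun _ => zero_le) fun n => ?_
    refine le_trans (eLpNorm_congr_ae ?_).le (eLpNorm_mono_measure _ Measure.restrict_le_self)
    exact (ae_eq_refl _).sub (zeroExt_ae_eq hKm hKΩ f₀).symm
  have hvlim := fun a => hrestr (h a).memLp (h a).measurable
  have hglim : ∀ a b, Tendsto (fun n => eLpNorm (fun x => jacobian c (v n) x a b -
      gradMatrix c g x a b) k (volume.restrict K)) atTop (𝓝 0) := by
    intro a b
    refine (hrestr ((h a).memLp_grad (c b)) ((h a).measurable_grad (c b))).congr' ?_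
    filter_upwards [(tendsto_bumpSeq_rOut N).eventually (ge_mem_nhds hr)] with n hn
    refine eLpNorm_congr_ae ((ae_restrict_iff' hKm).2 (Eventually.of_forall fun x hx => ?_))
    have := partialDeriv_mollify (bumpSeq N n) (hloc a) ((h a).weak (c b))
      ((Metric.closedBall_subset_closedBall hn).trans (hball x hx))
    simp only [jacobian, gradMatrix, hv, this]
  have hJ : ∀ n a b, MemLp (fun x => jacobian c (v n) x a b) k (volume.restrict K) := fun n a b =>
    memLp_restrict_of_continuous hK (contDiff_partialDeriv (hvs n a) _).continuous _
  have hG : ∀ a b, MemLp (fun x => gradMatrix c g x a b) k (volume.restrict K) := fun a b =>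
    memLp_restrict_of_subset hKΩ ((h a).memLp_grad _)
  have hleft : Tendsto (fun n => ∫ x in K, φ x * (jacobian c (v n) x).det) atTop
      (𝓝 (∫ x in K, φ x * (gradMatrix c g x).det)) := by
    have := tendsto_integral_det_updateRow hk hJ hG hglim i
      (s := fun n b x => φ x * jacobian c (v n) x i b) (s₀ := fun b x => φ x * gradMatrix c g x i b)
      (fun n b => memLp_mul_of_bound (hJ n i b) hφs.continuous.aestronglyMeasurable hM)
      (fun b => memLp_mul_of_bound (hG i b) hφs.continuous.aestronglyMeasurable hM)
      (fun b => tendsto_eLpNorm_mul_sub hM (hglim i b))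
    have e : ∀ (A : Eucl N → Matrix (Fin k) (Fin k) ℝ) x,
        ((A x).updateRow i fun b => φ x * A x i b).det = φ x * (A x).det := fun A x =>
      det_updateRow_smul_self (A x) i (φ x)
    simpa only [e] using this
  have hright : Tendsto (fun n => ∫ x in K,
      ((jacobian c (v n) x).updateRow i fun b => partialDeriv φ (c b) x * v n i x).det) atTop
      (𝓝 (∫ x in K,
        ((gradMatrix c g x).updateRow i fun b => partialDeriv φ (c b) x * f i x).det)) := by
    have hbd : ∀ b, ∃ M', ∀ x, ‖partialDeriv φ (c b) x‖ ≤ M' := fun b =>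
      (continuous_partialDeriv φ (c b)).bounded_above_of_compact_support
        (hasCompactSupport_partialDeriv φ (c b))
    choose M' hM' using hbd
    have hfi : MemLp (f i) k (volume.restrict K) := memLp_restrict_of_subset hKΩ (h i).memLp
    exact tendsto_integral_det_updateRow hk hJ hG hglim i
      (s := fun n b x => partialDeriv φ (c b) x * v n i x)
      (s₀ := fun b x => partialDeriv φ (c b) x * f i x)
      (fun n b => memLp_mul_of_bound (memLp_restrict_of_continuous hK (hvs n i).continuous _)
        (continuous_partialDeriv φ (c b)).aestronglyMeasurable (hM' b))
      (fun b => memLp_mul_of_bound hfi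
        (continuous_partialDeriv φ (c b)).aestronglyMeasurable (hM' b))
      (fun b => tendsto_eLpNorm_mul_sub (hM' b) (hvlim i))
  have hzero : ∀ (A : Eucl N → Matrix (Fin k) (Fin k) ℝ) (w : Eucl N → ℝ), ∀ x ∉ K,
      ((A x).updateRow i fun b => partialDeriv φ (c b) x * w x).det = 0 := fun A w x hx =>
    Matrix.det_eq_zero_of_row_eq_zero i
      (by simp [partialDeriv_eq_zero_of_notMem_tsupport hx])
  have hsm : ∀ n, ∫ x in K, φ x * (jacobian c (v n) x).det = - ∫ x in K,
      ((jacobian c (v n) x).updateRow i fun b => partialDeriv φ (c b) x * v n i x).det := by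
    intro n
    rw [setIntegral_eq_integral_of_forall_compl_eq_zero fun x hx => by rw [hφ0 x hx, zero_mul],
      setIntegral_eq_integral_of_forall_compl_eq_zero (hzero (jacobian c (v n)) (v n i)),
      integral_mul_det_jacobian c (hvs n) hφs hφc i]
    congr 1
    refine integral_congr_ae (Eventually.of_forall fun x => ?_)
    change v n i x * _ = _
    rw [← Matrix.det_updateRow_smul]
    congr 2
    funext b
    simp [mul_comm]
  have hfinal := tendsto_nhds_unique hleft ((hright.neg).congr fun n => (hsm n).symm)
  have hswap : ∀ x b, f i x * partialDeriv φ (c b) x = partialDeriv φ (c b) x * f i x :=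
    fun x b => mul_comm _ _
  simp only [hswap]
  rw [integral_lebesgueOn_eq_setIntegral hKΩ fun x hx => by rw [hφ0 x hx, zero_mul],
    integral_lebesgueOn_eq_setIntegral hKΩ (hzero (gradMatrix c g) (f i))]
  exact hfinal

/-! ### Weak continuity of Jacobian determinants -/

/-- Jacobian determinants of order `k` are weakly continuous on `W^{1,k}(Ω)` in the sense of
distributions: in each term of the telescoping sum one row is the gradient of a function that tends
to zero strongly, and integration by parts moves the derivatives from this row to `φ`. -/
theorem tendsto_integral_mul_det_gradMatrix (hk : 1 ≤ k) (c : Fin k → Fin N)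
    {Ω : Opens (Eucl N)} (hΩ : Bornology.IsBounded (Ω : Set (Eucl N)))
    {f : ℕ → Fin k → Eucl N → ℝ} {g : ℕ → Fin k → Fin N → Eucl N → ℝ}
    {f₀ : Fin k → Eucl N → ℝ} {g₀ : Fin k → Fin N → Eucl N → ℝ}
    (h : ∀ n a, IsW1 Ω k (f n a) (g n a)) (h₀ : ∀ a, IsW1 Ω k (f₀ a) (g₀ a))
    {C : ℝ≥0∞} (hC : C ≠ ⊤) (hb : ∀ n a, eLpNorm (f n a) k (lebesgueOn Ω) ≤ C)
    (hbg : ∀ n a i, eLpNorm (g n a i) k (lebesgueOn Ω) ≤ C)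
    (hw : ∀ a, ∀ ψ : Eucl N → ℝ, Continuous ψ → HasCompactSupport ψ →
      Tendsto (fun n => ∫ x, f n a x * ψ x ∂(lebesgueOn Ω)) atTop
        (𝓝 (∫ x, f₀ a x * ψ x ∂(lebesgueOn Ω))))
    (φ : TestFunction Ω ℝ (⊤ : ℕ∞)) :
    Tendsto (fun n => ∫ x, φ x * (gradMatrix c (g n) x).det ∂(lebesgueOn Ω)) atTop
      (𝓝 (∫ x, φ x * (gradMatrix c g₀ x).det ∂(lebesgueOn Ω))) := by
  have hk1 : (1 : ℝ≥0∞) ≤ k := Nat.one_le_cast.2 hk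
  have hkt : (k : ℝ≥0∞) ≠ ⊤ := ENNReal.natCast_ne_top k
  set K := tsupport (φ : Eucl N → ℝ) with hKdef
  have hφs : ContDiff ℝ (⊤ : ℕ∞) (φ : Eucl N → ℝ) := TestFunctionClass.map_contDiff φ
  have hφc : HasCompactSupport (φ : Eucl N → ℝ) := TestFunctionClass.map_hasCompactSupport φ
  have hK : IsCompact K := hφc
  have hKΩ : K ⊆ Ω := TestFunctionClass.tsupport_map_subset φ
  obtain ⟨M, hM⟩ := hφs.continuous.bounded_above_of_compact_support hφc
  -- A common bound for the sequence, the limit and the differences.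
  set D : ℝ≥0∞ := C + (∑ a, eLpNorm (f₀ a) k (lebesgueOn Ω)) +
    ∑ a, ∑ j, eLpNorm (g₀ a j) k (lebesgueOn Ω) with hD
  have hDtop : D ≠ ⊤ := by
    refine ENNReal.add_ne_top.2 ⟨ENNReal.add_ne_top.2 ⟨hC, ?_⟩, ?_⟩
    · exact (ENNReal.sum_lt_top.2 fun a _ => (h₀ a).memLp.2).ne
    · exact (ENNReal.sum_lt_top.2 fun a _ => ENNReal.sum_lt_top.2 fun j _ =>
        ((h₀ a).memLp_grad j).2).ne
  have hCD : C ≤ D := le_self_add.trans le_self_add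
  have hfD : ∀ n a, eLpNorm (fun x => f n a x - f₀ a x) k (lebesgueOn Ω) ≤ D := by
    intro n a
    refine (eLpNorm_sub_le (h n a).memLp.1 (h₀ a).memLp.1 hk1).trans ?_
    refine le_trans ?_ le_self_add
    gcongr
    · exact hb n a
    · exact Finset.single_le_sum (f := fun a => eLpNorm (f₀ a) k (lebesgueOn Ω))
        (fun _ _ => zero_le) (Finset.mem_univ a)
  have hg₀ : ∀ a j, eLpNorm (g₀ a j) k (lebesgueOn Ω) ≤
      ∑ a, ∑ j, eLpNorm (g₀ a j) k (lebesgueOn Ω) := fun a j =>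
    (Finset.single_le_sum (f := fun j => eLpNorm (g₀ a j) k (lebesgueOn Ω))
      (fun _ _ => zero_le) (Finset.mem_univ j)).trans
    (Finset.single_le_sum (f := fun a => ∑ j, eLpNorm (g₀ a j) k (lebesgueOn Ω))
      (fun _ _ => zero_le) (Finset.mem_univ a))
  have hgD : ∀ n a j, eLpNorm (fun x => g n a j x - g₀ a j x) k (lebesgueOn Ω) ≤ D := by
    intro n a j
    refine (eLpNorm_sub_le ((h n a).memLp_grad j).1 ((h₀ a).memLp_grad j).1 hk1).trans ?_
    exact add_le_add ((hbg n a j).trans le_self_add) (hg₀ a j)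
  -- The functions in the rows of the `i`-th term of the telescoping sum.
  set F : Fin k → ℕ → Fin k → Eucl N → ℝ := fun i n a =>
    if a < i then f n a else if a = i then fun x => f n i x - f₀ i x else f₀ a with hF
  set G : Fin k → ℕ → Fin k → Fin N → Eucl N → ℝ := fun i n a =>
    if a < i then g n a else if a = i then fun j x => g n i j x - g₀ i j x else g₀ a with hG
  have hFG : ∀ i n a, IsW1 Ω k (F i n a) (G i n a) := by
    intro i n a
    simp only [hF, hG]
    split_ifs
    · exact h n a
    · exact (h n i).sub hk1 (h₀ i)
    · exact h₀ a
  have hGD : ∀ i n a j, eLpNorm (G i n a j) k (lebesgueOn Ω) ≤ D := by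
    intro i n a j
    simp only [hG]
    split_ifs
    · exact (hbg n a j).trans hCD
    · exact hgD n i j
    · exact (hg₀ a j).trans le_add_self
  have hrow : ∀ i n x, rowInterpolation (gradMatrix c (g n) x) (gradMatrix c g₀ x) i =
      gradMatrix c (G i n) x := by
    intro i n x
    ext a b
    simp only [rowInterpolation, gradMatrix, hG]
    split_ifs <;> simp [gradMatrix]
  have hint : ∀ {g' : Fin k → Fin N → Eucl N → ℝ}, (∀ a j, MemLp (g' a j) k (lebesgueOn Ω)) →
      Integrable (fun x => φ x * (gradMatrix c g' x).det) (lebesgueOn Ω) := by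
    intro g' hg'
    have h1 : MemLp (fun x => (gradMatrix c g' x).det) 1 (lebesgueOn Ω) :=
      memLp_det hk le_rfl (by simpa [gradMatrix] using fun a b => hg' a (c b))
    exact memLp_one_iff_integrable.1
      (memLp_mul_of_bound h1 hφs.continuous.aestronglyMeasurable hM)
  have hdiff : ∀ n, ∫ x, φ x * (gradMatrix c (g n) x).det ∂(lebesgueOn Ω) =
      ∫ x, φ x * (gradMatrix c g₀ x).det ∂(lebesgueOn Ω) +
      ∑ i, ∫ x, φ x * (gradMatrix c (G i n) x).det ∂(lebesgueOn Ω) := by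
    intro n
    rw [← integral_finsetSum _ fun i _ => hint fun a j => (hFG i n a).memLp_grad j,
      ← integral_add (hint fun a j => (h₀ a).memLp_grad j)
        (integrable_finsetSum _ fun i _ => hint fun a j => (hFG i n a).memLp_grad j)]
    refine integral_congr_ae (Eventually.of_forall fun x => ?_)
    have := det_sub_det_eq_sum (gradMatrix c (g n) x) (gradMatrix c g₀ x)
    simp only [hrow] at this
    simp only [← Finset.mul_sum, ← this]
    ring
  have hterm : ∀ i, Tendsto (fun n => ∫ x, φ x * (gradMatrix c (G i n) x).det ∂(lebesgueOn Ω))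
      atTop (𝓝 0) := by
    intro i
    have hFi : ∀ n, F i n i = fun x => f n i x - f₀ i x := fun n => by simp [hF]
    have hGi : ∀ n, G i n i = fun j x => g n i j x - g₀ i j x := fun n => by simp [hG]
    have hstrong : Tendsto (fun n => eLpNorm (F i n i) k (volume.restrict K)) atTop (𝓝 0) := by
      refine tendsto_eLpNorm_zero_of_weak hΩ hk1 hkt (fun n => hFG i n i) hDtop
        (fun n => by rw [hFi]; exact hfD n i) (fun n j => hGD i n i j) ?_ hK hKΩ
      intro ψ hψ hψc
      have hlim := (hw i ψ hψ hψc).sub_const (∫ x, f₀ i x * ψ x ∂(lebesgueOn Ω))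
      rw [sub_self] at hlim
      refine hlim.congr fun n => ?_
      rw [← integral_sub (integrable_mul_of_memLp hk1 (h n i).memLp hψ hψc)
        (integrable_mul_of_memLp hk1 (h₀ i).memLp hψ hψc), hFi]
      simp only [sub_mul]
    have hbd : ∀ b, ∃ M', ∀ x, ‖partialDeriv φ (c b) x‖ ≤ M' := fun b =>
      (continuous_partialDeriv φ (c b)).bounded_above_of_compact_support
        (hasCompactSupport_partialDeriv φ (c b))
    choose M' hM' using hbd
    have hIBP : ∀ n, ∫ x, φ x * (gradMatrix c (G i n) x).det ∂(lebesgueOn Ω) = - ∫ x in K,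
        ((gradMatrix c (G i n) x).updateRow i
          fun b => partialDeriv φ (c b) x * F i n i x).det := by
      intro n
      rw [integral_mul_det_gradMatrix hk c (hFG i n) φ i,
        ← integral_lebesgueOn_eq_setIntegral hKΩ fun x hx =>
          Matrix.det_eq_zero_of_row_eq_zero i
            (by simp [partialDeriv_eq_zero_of_notMem_tsupport hx])]
      simp only [mul_comm]
    have hrowle : ∀ n b, eLpNorm (fun x => partialDeriv φ (c b) x * F i n i x) k
        (volume.restrict K) ≤ ENNReal.ofReal (M' b) * eLpNorm (F i n i) k (volume.restrict K) :=
      fun n b => eLpNorm_le_mul_eLpNorm_of_ae_le_mul (Eventually.of_forall fun x => by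
        rw [norm_mul]; exact mul_le_mul_of_nonneg_right (hM' b x) (norm_nonneg _)) k
    have hrowlim : ∀ b, Tendsto (fun n => eLpNorm (fun x => partialDeriv φ (c b) x * F i n i x) k
        (volume.restrict K)) atTop (𝓝 0) := by
      intro b
      have h1 := ENNReal.Tendsto.const_mul hstrong (a := ENNReal.ofReal (M' b))
        (Or.inr ENNReal.ofReal_ne_top)
      rw [mul_zero] at h1
      exact tendsto_of_tendsto_of_tendsto_of_le_of_le tendsto_const_nhds h1 (fun _ => zero_le)
        fun n => hrowle n b
    have hmem : ∀ n a b, MemLp (fun x => (gradMatrix c (G i n) x).updateRow i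
        (fun b => partialDeriv φ (c b) x * F i n i x) a b) k (volume.restrict K) := by
      intro n a b
      by_cases hai : a = i
      · subst hai
        simpa using memLp_mul_of_bound (memLp_restrict_of_subset hKΩ (hFG a n a).memLp)
          (continuous_partialDeriv φ (c b)).aestronglyMeasurable (hM' b)
      · simp only [Matrix.updateRow_ne hai]
        exact memLp_restrict_of_subset hKΩ ((hFG i n a).memLp_grad (c b))
    have hdet := tendsto_eLpNorm_det_zero hk (μ := volume.restrict K) (C := D + 1) (l := atTop)
      (A := fun n x => (gradMatrix c (G i n) x).updateRow i
        fun b => partialDeriv φ (c b) x * F i n i x) ?_ (by simp [hDtop]) ?_ i ?_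
    · have hint0 := tendsto_integral_of_L1' (μ := volume.restrict K) (l := atTop)
        (F := fun n x => ((gradMatrix c (G i n) x).updateRow i
          fun b => partialDeriv φ (c b) x * F i n i x).det) (fun _ => (0 : ℝ))
        aestronglyMeasurable_const (Eventually.of_forall fun n => ?_) ?_
      · rw [integral_zero] at hint0
        simpa only [hIBP, neg_zero] using hint0.neg
      · exact memLp_one_iff_integrable.1 (memLp_det hk le_rfl (by simpa only [mul_one] using hmem n))
      · refine hdet.congr fun n => ?_
        congr 1
        funext x
        simp
    · exact fun n a b => (hmem n a b).1
    · have hsmall : ∀ᶠ n in atTop, ∀ b, eLpNorm (fun x => partialDeriv φ (c b) x * F i n i x) k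
          (volume.restrict K) ≤ 1 :=
        eventually_all.2 fun b => (hrowlim b).eventually (ge_mem_nhds one_pos)
      filter_upwards [hsmall] with n hn a b
      by_cases hai : a = i
      · subst hai
        simpa using (hn b).trans le_add_self
      · simp only [Matrix.updateRow_ne hai]
        exact ((eLpNorm_mono_measure _ (Measure.restrict_mono_set _ hKΩ)).trans
            (hGD i n a (c b))).trans (le_self_add (b := 1))
    · intro b
      simpa using hrowlim b
  have hsum := tendsto_finsetSum Finset.univ fun i _ => hterm i
  have := hsum.const_add (∫ x, φ x * (gradMatrix c g₀ x).det ∂(lebesgueOn Ω))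
  rw [Finset.sum_const_zero, add_zero] at this
  exact this.congr fun n => (hdiff n).symm

/-! ### The dual of `L^q` -/

section LpDual

variable {X : Type*} [MeasurableSpace X] {μ : Measure X} [IsFiniteMeasure μ]
  {q q' : ℝ≥0∞} [Fact (1 ≤ q)]

/-- Functionals on `L^q` of a finite measure space are determined by their values on indicators. -/
theorem clm_Lp_ext (hq : q ≠ ⊤) {S T : Lp ℝ q μ →L[ℝ] ℝ}
    (h : ∀ s (hs : MeasurableSet s), S (indicatorConstLp q hs (measure_ne_top μ s) 1) =
      T (indicatorConstLp q hs (measure_ne_top μ s) 1)) : S = T := by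
  ext f
  refine Lp.induction hq (fun f => S f = T f) ?_ ?_ ?_ f
  · intro c s hs hμs
    have e : (Lp.simpleFunc.indicatorConst q hs hμs.ne c : Lp ℝ q μ) =
        c • indicatorConstLp q hs (measure_ne_top μ s) (1 : ℝ) := by
      rw [Lp.simpleFunc.coe_indicatorConst]
      refine Lp.ext ?_
      filter_upwards [indicatorConstLp_coeFn (p := q) (hs := hs) (hμs := hμs.ne) (c := c),
        Lp.coeFn_smul c (indicatorConstLp q hs (measure_ne_top μ s) (1 : ℝ)),
        indicatorConstLp_coeFn (p := q) (hs := hs) (hμs := measure_ne_top μ s) (c := (1 : ℝ))]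
        with x h1 h2 h3
      rw [h1, h2, Pi.smul_apply, h3]
      by_cases hx : x ∈ s <;> simp [hx]
    rw [e, map_smul, map_smul, h s hs]
  · intro f g hf hg _ h1 h2
    rw [map_add, map_add, h1, h2]
  · exact isClosed_eq S.continuous T.continuous

open Classical in
/-- The signed measure `s ↦ ℓ(1_s)` of a functional `ℓ` on `L^q`. -/
noncomputable def dualMeasure (hq : q ≠ ⊤) (l : Lp ℝ q μ →L[ℝ] ℝ) : SignedMeasure X where
  measureOf' s := if hs : MeasurableSet s then
    l (indicatorConstLp q hs (measure_ne_top μ s) 1) else 0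
  empty' := by simp
  not_measurable' s hs := by simp [hs]
  m_iUnion' A hA hdisj := by
    have hU : MeasurableSet (⋃ i, A i) := MeasurableSet.iUnion hA
    have hfin : ∀ s : Finset ℕ, MeasurableSet (⋃ i ∈ s, A i) := fun s =>
      Finset.measurableSet_biUnion s fun i _ => hA i
    simp only [hA, hU, dif_pos]
    have hsum : ∀ s : Finset ℕ, ∑ i ∈ s, l (indicatorConstLp q (hA i) (measure_ne_top μ _) 1) =
        l (indicatorConstLp q (hfin s) (measure_ne_top μ _) 1) := by
      intro s
      rw [← map_sum]
      congr 1
      refine Lp.ext ?_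
      have h1 : ∀ᵐ x ∂μ, ∀ i, indicatorConstLp q (hA i) (measure_ne_top μ _) (1 : ℝ) x =
          (A i).indicator (fun _ => 1) x := ae_all_iff.2 fun i => indicatorConstLp_coeFn
      filter_upwards [h1, Lp.coeFn_finsetSum s fun i =>
        indicatorConstLp q (hA i) (measure_ne_top μ (A i)) (1 : ℝ),
        indicatorConstLp_coeFn (p := q) (hs := hfin s) (hμs := measure_ne_top μ _) (c := (1 : ℝ))]
        with x h1 h2 h3
      rw [h2, h3, Finset.sum_apply]
      simp only [h1]
      rw [Finset.indicator_biUnion_apply]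
      exact fun i _ j _ hij => hdisj hij
    unfold HasSum
    simp only [hsum]
    refine (l.continuous.tendsto _).comp (tendsto_indicatorConstLp_set hq ?_)
    have hmono : Monotone fun s : Finset ℕ => ⋃ i ∈ s, A i := fun s t hst =>
      Set.biUnion_subset_biUnion_left hst
    have hUeq : (⋃ s : Finset ℕ, ⋃ i ∈ s, A i) = ⋃ i, A i := by
      rw [← Set.iUnion_eq_iUnion_finset]
    have hlim := tendsto_measure_iUnion_atTop (μ := μ) hmono
    rw [hUeq] at hlim
    have hsub := ENNReal.Tendsto.sub (tendsto_const_nhds (x := μ (⋃ i, A i))) hlim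
      (Or.inl (measure_ne_top _ _))
    rw [tsub_self] at hsub
    refine hsub.congr fun s => ?_
    have hss : (⋃ i ∈ s, A i) ⊆ ⋃ i, A i := Set.iUnion₂_subset_iUnion _ _
    rw [Set.symmDiff_def, Set.sdiff_eq_empty.2 hss, Set.empty_union,
      measure_sdiff hss (hfin s).nullMeasurableSet (measure_ne_top _ _)]
    rfl

theorem dualMeasure_apply (hq : q ≠ ⊤) (l : Lp ℝ q μ →L[ℝ] ℝ) {s : Set X} (hs : MeasurableSet s) :
    dualMeasure hq l s = l (indicatorConstLp q hs (measure_ne_top μ s) 1) :=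
  dif_pos hs

/-- The density is the Radon–Nikodym derivative of `dualMeasure`. -/
theorem exists_integrable_forall_indicator (hq : q ≠ ⊤) (l : Lp ℝ q μ →L[ℝ] ℝ) :
    ∃ g : X → ℝ, Measurable g ∧ Integrable g μ ∧ ∀ s (hs : MeasurableSet s),
      l (indicatorConstLp q hs (measure_ne_top μ s) 1) = ∫ x in s, g x ∂μ := by
  refine ⟨(dualMeasure hq l).rnDeriv μ, SignedMeasure.measurable_rnDeriv _ _,
    SignedMeasure.integrable_rnDeriv _ _, fun s hs => ?_⟩
  have hac : dualMeasure hq l ≪ᵥ μ.toENNRealVectorMeasure := by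
    refine VectorMeasure.AbsolutelyContinuous.mk fun s hs h0 => ?_
    rw [Measure.toENNRealVectorMeasure_apply_measurable hs] at h0
    rw [dualMeasure_apply hq l hs]
    have : indicatorConstLp q hs (measure_ne_top μ s) (1 : ℝ) = 0 := by
      refine Lp.ext ?_
      have h1 : ∀ᵐ x ∂μ, x ∉ s := measure_eq_zero_iff_ae_notMem.1 h0
      filter_upwards [h1, Lp.coeFn_zero ℝ q μ,
        indicatorConstLp_coeFn (p := q) (hs := hs) (hμs := measure_ne_top μ s) (c := (1 : ℝ))]
        with x h1 h2 h3
      rw [h2, h3]; simp [h1]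
    rw [this, map_zero]
  have h := SignedMeasure.withDensityᵥ_rnDeriv_eq (dualMeasure hq l) μ hac
  rw [← dualMeasure_apply hq l hs]
  conv_lhs => rw [← h]
  rw [withDensityᵥ_apply (SignedMeasure.integrable_rnDeriv _ _) hs]

theorem lpPairing_indicator [Fact (1 ≤ q')] [ENNReal.HolderConjugate q' q] {g : X → ℝ}
    (hg : MemLp g q' μ) {s : Set X} (hs : MeasurableSet s) :
    (ContinuousLinearMap.mul ℝ ℝ).lpPairing μ q' q (hg.toLp g)
      (indicatorConstLp q hs (measure_ne_top μ s) 1) = ∫ x in s, g x ∂μ := by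
  rw [ContinuousLinearMap.lpPairing_eq_integral, ← integral_indicator hs]
  refine integral_congr_ae ?_
  filter_upwards [hg.coeFn_toLp,
    indicatorConstLp_coeFn (p := q) (hs := hs) (hμs := measure_ne_top μ s) (c := (1 : ℝ))]
    with x h1 h2
  rw [h1, h2]
  by_cases hx : x ∈ s <;> simp [hx]

/-- Testing `ℓ` with `|g|^{q'-2} g` bounds the `L^{q'}` norm of a bounded `g` that represents it. -/
theorem eLpNorm_le_norm_of_bounded [Fact (1 ≤ q')] [ENNReal.HolderConjugate q' q] (hq : q ≠ ⊤)
    (hq' : q' ≠ ⊤) {g : X → ℝ} (hg : Measurable g) {M : ℝ} (hM : ∀ x, ‖g x‖ ≤ M) {L : ℝ}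
    (hL : ∀ f : X → ℝ, MemLp f q μ → ∫ x, f x * g x ∂μ ≤ L * (eLpNorm f q μ).toReal) :
    eLpNorm g q' μ ≤ ENNReal.ofReal L := by
  have hq0 : q ≠ 0 := (one_pos.trans_le (Fact.out : 1 ≤ q)).ne'
  have hq'0 : q' ≠ 0 := (one_pos.trans_le (Fact.out : 1 ≤ q')).ne'
  have hconj : q'.toReal.HolderConjugate q.toReal :=
    ENNReal.HolderConjugate.toReal_of_ne_top (p := q') (q := q) hq' hq
  set r := q.toReal with hr
  set r' := q'.toReal with hr'
  have hr'1 : 1 < r' := hconj.lt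
  have hgq' : MemLp g q' μ := MemLp.of_bound hg.aestronglyMeasurable M (Eventually.of_forall hM)
  set f : X → ℝ := fun x => ‖g x‖ ^ (r' - 2) * g x with hf
  have hfm : Measurable f := (hg.norm.pow_const _).mul hg
  have hfn : ∀ x, ‖f x‖ = ‖g x‖ ^ (r' - 1) := by
    intro x
    simp only [hf, norm_mul]
    rw [Real.norm_of_nonneg (Real.rpow_nonneg (norm_nonneg _) _)]
    rcases (norm_nonneg (g x)).eq_or_lt with h | h
    · rw [← h, mul_zero, Real.zero_rpow (by linarith)]
    · rw [← Real.rpow_add_one h.ne']; congr 1; ring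
  have hfq : MemLp f q μ := by
    refine MemLp.of_bound hfm.aestronglyMeasurable (M ^ (r' - 1)) (Eventually.of_forall fun x => ?_)
    rw [hfn]
    exact Real.rpow_le_rpow (norm_nonneg _) (hM x) (by linarith)
  have hfg : ∀ x, f x * g x = ‖g x‖ ^ r' := by
    intro x
    simp only [hf]
    rw [mul_assoc, ← pow_two, ← sq_abs, ← Real.norm_eq_abs]
    rcases (norm_nonneg (g x)).eq_or_lt with h | h
    · rw [← h, Real.zero_rpow (by linarith : r' ≠ 0)]; simp
    · rw [← Real.rpow_natCast, ← Real.rpow_add h]; congr 1; push_cast; ring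
  set b := ∫ x, ‖g x‖ ^ r' ∂μ with hb
  have hb0 : 0 ≤ b := integral_nonneg fun x => Real.rpow_nonneg (norm_nonneg _) _
  have hgn : eLpNorm g q' μ = ENNReal.ofReal (b ^ r'⁻¹) :=
    hgq'.eLpNorm_eq_integral_rpow_norm hq'0 hq'
  have hfnorm : eLpNorm f q μ = ENNReal.ofReal (b ^ r⁻¹) := by
    rw [hfq.eLpNorm_eq_integral_rpow_norm hq0 hq]
    congr 2
    refine integral_congr_ae (Eventually.of_forall fun x => ?_)
    change ‖f x‖ ^ r = ‖g x‖ ^ r'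
    rw [hfn, ← Real.rpow_mul (norm_nonneg _), hconj.sub_one_mul_conj]
  have hmain := hL f hfq
  simp only [hfg] at hmain
  rw [hfnorm, ENNReal.toReal_ofReal (Real.rpow_nonneg hb0 _)] at hmain
  rw [hgn]
  rcases hb0.eq_or_lt with h | h
  · rw [← h, Real.zero_rpow (inv_ne_zero (by linarith : r' ≠ 0))]
    simp
  · refine ENNReal.ofReal_le_ofReal ?_
    have hsplit : b = b ^ r'⁻¹ * b ^ r⁻¹ := by
      rw [← Real.rpow_add h, hconj.inv_add_inv_eq_one, Real.rpow_one]
    have hpos : 0 < b ^ r⁻¹ := Real.rpow_pos_of_pos h _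
    refine le_of_mul_le_mul_right ?_ hpos
    rw [← hsplit]
    exact hmain

/-- The Riesz representation theorem: for `1 < q < ∞`, functionals on `L^q` of a finite measure space
are given by functions in `L^{q'}`. -/
theorem exists_memLp_forall_eq_integral [Fact (1 ≤ q')] [ENNReal.HolderConjugate q' q]
    (hq : q ≠ ⊤) (hq' : q' ≠ ⊤) (l : Lp ℝ q μ →L[ℝ] ℝ) :
    ∃ g : X → ℝ, MemLp g q' μ ∧ ∀ f : Lp ℝ q μ, l f = ∫ x, g x * f x ∂μ := by
  obtain ⟨g, hgm, hgi, hg⟩ := exists_integrable_forall_indicator hq l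
  -- The truncations `g 1_{|g| ≤ n}` represent `f ↦ ℓ(f 1_{|g| ≤ n})`.
  set A : ℕ → Set X := fun n => {x | ‖g x‖ ≤ n} with hA
  have hAm : ∀ n, MeasurableSet (A n) := fun n => measurableSet_le hgm.norm measurable_const
  set gn : ℕ → X → ℝ := fun n => (A n).indicator g with hgn
  have hgnm : ∀ n, Measurable (gn n) := fun n => hgm.indicator (hAm n)
  have hgnb : ∀ n x, ‖gn n x‖ ≤ n := by
    intro n x
    by_cases hx : x ∈ A n
    · simp only [hgn, Set.indicator_of_mem hx]
      exact hx
    · simp [hgn, hx]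
  have hgnq : ∀ n, MemLp (gn n) q' μ := fun n =>
    MemLp.of_bound (hgnm n).aestronglyMeasurable n (Eventually.of_forall (hgnb n))
  have hrepr : ∀ n, l.comp ((ContinuousLinearMap.mul ℝ ℝ).holderL μ ⊤ q q
      (indicatorConstLp ⊤ (hAm n) (measure_ne_top μ _) 1)) =
      (ContinuousLinearMap.mul ℝ ℝ).lpPairing μ q' q ((hgnq n).toLp (gn n)) := by
    intro n
    refine clm_Lp_ext hq fun s hs => ?_
    rw [lpPairing_indicator (hgnq n) hs, ContinuousLinearMap.comp_apply]
    have e : (ContinuousLinearMap.mul ℝ ℝ).holderL μ ⊤ q q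
        (indicatorConstLp ⊤ (hAm n) (measure_ne_top μ _) 1)
        (indicatorConstLp q hs (measure_ne_top μ s) 1) =
        indicatorConstLp q (hs.inter (hAm n)) (measure_ne_top μ _) (1 : ℝ) := by
      refine Lp.ext ?_
      filter_upwards [(ContinuousLinearMap.mul ℝ ℝ).coeFn_holder (r := q)
          (indicatorConstLp ⊤ (hAm n) (measure_ne_top μ _) 1)
          (indicatorConstLp q hs (measure_ne_top μ s) 1),
        indicatorConstLp_coeFn (p := q) (hs := hs) (hμs := measure_ne_top μ s) (c := (1 : ℝ)),
        indicatorConstLp_coeFn (p := ⊤) (hs := hAm n) (hμs := measure_ne_top μ _) (c := (1 : ℝ)),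
        indicatorConstLp_coeFn (p := q) (hs := hs.inter (hAm n)) (hμs := measure_ne_top μ _)
          (c := (1 : ℝ))] with x h1 h2 h3 h4
      rw [ContinuousLinearMap.holderL_apply_apply, h1, h2, h3, h4]
      by_cases hx : x ∈ s <;> by_cases hxA : x ∈ A n <;> simp [hx, hxA]
    rw [e, hg, setIntegral_indicator (hAm n)]
  have hbound : ∀ n, eLpNorm (gn n) q' μ ≤ ENNReal.ofReal ‖l‖ := by
    intro n
    refine eLpNorm_le_norm_of_bounded hq hq' (hgnm n) (hgnb n) fun f hf => ?_
    have h1 := congrArg (fun T => T (hf.toLp f)) (hrepr n)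
    have h2 : ∫ x, f x * gn n x ∂μ =
        (ContinuousLinearMap.mul ℝ ℝ).lpPairing μ q' q ((hgnq n).toLp (gn n)) (hf.toLp f) := by
      rw [ContinuousLinearMap.lpPairing_eq_integral]
      refine integral_congr_ae ?_
      filter_upwards [(hgnq n).coeFn_toLp, hf.coeFn_toLp] with x e1 e2
      rw [e1, e2, ContinuousLinearMap.mul_apply', mul_comm]
    rw [h2, ← h1, ContinuousLinearMap.comp_apply]
    refine (le_abs_self _).trans ((l.le_opNorm _).trans ?_)
    refine mul_le_mul_of_nonneg_left ?_ (norm_nonneg _)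
    rw [Lp.norm_def]
    refine ENNReal.toReal_mono hf.2.ne ?_
    refine eLpNorm_mono_ae ?_
    filter_upwards [(ContinuousLinearMap.mul ℝ ℝ).coeFn_holder (r := q)
        (indicatorConstLp ⊤ (hAm n) (measure_ne_top μ _) 1) (hf.toLp f), hf.coeFn_toLp,
      indicatorConstLp_coeFn (p := ⊤) (hs := hAm n) (hμs := measure_ne_top μ _) (c := (1 : ℝ))]
      with x h1 h2 h3
    rw [ContinuousLinearMap.holderL_apply_apply, h1, h2, h3]
    by_cases hxA : x ∈ A n <;> simp [hxA]
  have hgq' : MemLp g q' μ := by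
    refine ⟨hgm.aestronglyMeasurable, ?_⟩
    have hlim : ∀ᵐ x ∂μ, Tendsto (fun n => gn n x) atTop (𝓝 (g x)) := by
      refine Eventually.of_forall fun x => tendsto_const_nhds.congr' ?_
      filter_upwards [eventually_ge_atTop ⌈‖g x‖⌉₊] with n hn
      have : x ∈ A n := (Nat.le_ceil _).trans (Nat.cast_le.2 hn)
      simp [hgn, this]
    refine lt_of_le_of_lt (Lp.eLpNorm_lim_le_liminf_eLpNorm
      (fun n => (hgnm n).aestronglyMeasurable) g hlim) 
      (lt_of_le_of_lt ?_ (ENNReal.ofReal_lt_top (r := ‖l‖)))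
    exact liminf_le_of_frequently_le' (Frequently.of_forall hbound)
  refine ⟨g, hgq', fun f => ?_⟩
  have hl : l = (ContinuousLinearMap.mul ℝ ℝ).lpPairing μ q' q (hgq'.toLp g) :=
    clm_Lp_ext hq fun s hs => by rw [hg s hs, lpPairing_indicator hgq' hs]
  rw [hl, ContinuousLinearMap.lpPairing_eq_integral]
  refine integral_congr_ae ?_
  filter_upwards [hgq'.coeFn_toLp] with x hx
  rw [hx, ContinuousLinearMap.mul_apply']

end LpDual

/-! ### Enlarging the class of test functions -/

theorem tendsto_of_forall_approx {a : ℕ → ℝ} {a₀ : ℝ}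
    (h : ∀ ε > 0, ∃ (b : ℕ → ℝ) (b₀ : ℝ), Tendsto b atTop (𝓝 b₀) ∧
      (∀ n, |a n - b n| ≤ ε) ∧ |a₀ - b₀| ≤ ε) :
    Tendsto a atTop (𝓝 a₀) := by
  rw [Metric.tendsto_atTop]
  intro ε hε
  obtain ⟨b, b₀, hb, h1, h2⟩ := h (ε / 4) (by positivity)
  obtain ⟨m, hm⟩ := Metric.tendsto_atTop.1 hb (ε / 4) (by positivity)
  refine ⟨m, fun n hn => ?_⟩
  have h3 := hm n hn
  have h4 := h1 n
  rw [Real.dist_eq, abs_lt] at *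
  rw [abs_le] at h4 h2
  constructor <;> linarith

/-- The bound on the `L¹` norms makes the integrals equicontinuous in the test function for the
uniform norm. -/
theorem tendsto_integral_mul_of_uniform_approx {X : Type*} [MeasurableSpace X] {μ : Measure X}
    {h : ℕ → X → ℝ} {h₀ : X → ℝ} (hi : ∀ n, Integrable (h n) μ) (hi₀ : Integrable h₀ μ)
    {M : ℝ} (hM : ∀ n, ∫ x, |h n x| ∂μ ≤ M) {F : X → ℝ}
    (hF : ∀ n, Integrable (fun x => F x * h n x) μ) (hF₀ : Integrable (fun x => F x * h₀ x) μ)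
    (happ : ∀ ε > 0, ∃ G : X → ℝ, (∀ x, |F x - G x| ≤ ε) ∧
      (∀ n, Integrable (fun x => G x * h n x) μ) ∧ Integrable (fun x => G x * h₀ x) μ ∧
      Tendsto (fun n => ∫ x, G x * h n x ∂μ) atTop (𝓝 (∫ x, G x * h₀ x ∂μ))) :
    Tendsto (fun n => ∫ x, F x * h n x ∂μ) atTop (𝓝 (∫ x, F x * h₀ x ∂μ)) := by
  refine tendsto_of_forall_approx fun ε hε => ?_
  obtain ⟨M', hM'0, hM', hM'₀⟩ : ∃ M' > 0, (∀ n, ∫ x, |h n x| ∂μ ≤ M') ∧ ∫ x, |h₀ x| ∂μ ≤ M' := by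
    refine ⟨max (max M (∫ x, |h₀ x| ∂μ)) 1, lt_max_of_lt_right one_pos, fun n => ?_, ?_⟩
    · exact (hM n).trans ((le_max_left _ _).trans (le_max_left _ _))
    · exact (le_max_right _ _).trans (le_max_left _ _)
  obtain ⟨G, hG, hGi, hGi₀, hlim⟩ := happ (ε / M') (by positivity)
  have key : ∀ H : X → ℝ, Integrable H μ → ∫ x, |H x| ∂μ ≤ M' →
      Integrable (fun x => F x * H x) μ → Integrable (fun x => G x * H x) μ →
      |∫ x, F x * H x ∂μ - ∫ x, G x * H x ∂μ| ≤ ε := by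
    intro H hH hHM hFH hGH
    rw [← integral_sub hFH hGH]
    calc |∫ x, (F x * H x - G x * H x) ∂μ| ≤ ∫ x, |F x * H x - G x * H x| ∂μ :=
          abs_integral_le_integral_abs
      _ ≤ ∫ x, ε / M' * |H x| ∂μ := by
          refine integral_mono (hFH.sub hGH).abs (hH.abs.const_mul _) fun x => ?_
          simp only
          rw [← sub_mul, abs_mul]
          exact mul_le_mul_of_nonneg_right (hG x) (abs_nonneg _)
      _ = ε / M' * ∫ x, |H x| ∂μ := integral_const_mul _ _
      _ ≤ ε / M' * M' := by gcongr
      _ = ε := div_mul_cancel₀ _ hM'0.ne'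
  exact ⟨_, _, hlim, fun n => key _ (hi n) (hM' n) (hF n) (hGi n),
    key _ hi₀ hM'₀ hF₀ hGi₀⟩

/-- The bound on the `Lᵠ` norms makes the integrals equicontinuous in the test function for the
norm of the dual exponent. -/
theorem tendsto_integral_mul_of_eLpNorm_approx {X : Type*} [MeasurableSpace X] {μ : Measure X}
    {q' q : ℝ≥0∞} [ENNReal.HolderConjugate q' q]
    {h : ℕ → X → ℝ} {h₀ : X → ℝ} (hi : ∀ n, MemLp (h n) q μ) (hi₀ : MemLp h₀ q μ)
    {M : ℝ≥0∞} (hMtop : M ≠ ⊤) (hM : ∀ n, eLpNorm (h n) q μ ≤ M) {F : X → ℝ} (hF : MemLp F q' μ)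
    (happ : ∀ ε : ℝ≥0∞, ε ≠ 0 → ∃ G : X → ℝ, MemLp G q' μ ∧ eLpNorm (F - G) q' μ ≤ ε ∧
      Tendsto (fun n => ∫ x, G x * h n x ∂μ) atTop (𝓝 (∫ x, G x * h₀ x ∂μ))) :
    Tendsto (fun n => ∫ x, F x * h n x ∂μ) atTop (𝓝 (∫ x, F x * h₀ x ∂μ)) := by
  refine tendsto_of_forall_approx fun ε hε => ?_
  set M' : ℝ≥0∞ := M + eLpNorm h₀ q μ + 1 with hM'
  have hM'0 : M' ≠ 0 := by simp [hM']
  have hM'top : M' ≠ ⊤ := by simp [hM', hMtop, hi₀.2.ne]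
  obtain ⟨G, hG, hFG, hlim⟩ := happ (ENNReal.ofReal ε / M')
    (ENNReal.div_ne_zero.2 ⟨(ENNReal.ofReal_pos.2 hε).ne', hM'top⟩)
  have key : ∀ H : X → ℝ, MemLp H q μ → eLpNorm H q μ ≤ M' →
      |∫ x, F x * H x ∂μ - ∫ x, G x * H x ∂μ| ≤ ε := by
    intro H hH hHM
    have hFH : Integrable (fun x => F x * H x) μ := hF.integrable_mul hH
    have hGH : Integrable (fun x => G x * H x) μ := hG.integrable_mul hH
    rw [← integral_sub hFH hGH, ← Real.norm_eq_abs, ← ENNReal.ofReal_le_ofReal_iff hε.le,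
      ofReal_norm]
    calc ‖∫ x, (F x * H x - G x * H x) ∂μ‖ₑ ≤ ∫⁻ x, ‖F x * H x - G x * H x‖ₑ ∂μ :=
          enorm_integral_le_lintegral_enorm _
      _ = eLpNorm ((F - G) • H) 1 μ := by
          rw [eLpNorm_one_eq_lintegral_enorm]
          refine lintegral_congr fun x => ?_
          simp [sub_mul]
      _ ≤ eLpNorm (F - G) q' μ * eLpNorm H q μ := eLpNorm_smul_le_mul_eLpNorm hH.1 (hF.1.sub hG.1)
      _ ≤ ENNReal.ofReal ε / M' * M' := by gcongr
      _ = ENNReal.ofReal ε := ENNReal.div_mul_cancel hM'0 hM'top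
  refine ⟨_, _, hlim, fun n => key _ (hi n) ((hM n).trans ?_), key _ hi₀ ?_⟩
  · exact (le_add_right le_self_add)
  · exact (le_add_right le_add_self)

variable {Ω : Opens (Eucl N)}

/-- The approximating function is smooth on `ℝ^N` and has its support inside that of `F`. -/
theorem exists_testFunction_approx {F : Ω → ℝ} (hF : Continuous F) (hs : HasCompactSupport F)
    {ε : ℝ} (hε : 0 < ε) :
    ∃ φ : TestFunction Ω ℝ (⊤ : ℕ∞), ∀ x : Ω, |F x - φ x| ≤ ε := by
  have hcont : Continuous (Function.extend (Subtype.val : Ω → Eucl N) F 0) :=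
    HasCompactSupport.continuous_extend_zero Ω.isOpen hF hs
  have hcs : HasCompactSupport (Function.extend (Subtype.val : Ω → Eucl N) F 0) :=
    hs.extend_zero continuous_subtype_val
  have hts : tsupport (Function.extend (Subtype.val : Ω → Eucl N) F 0) ⊆ Ω :=
    (hs.tsupport_extend_zero_subset continuous_subtype_val).trans (Subtype.coe_image_subset _ _)
  obtain ⟨g, hg, hgd, hgs⟩ := hcont.exists_contDiff_approx ⊤ (ε := fun _ => ε) continuous_const
    (fun _ => hε)
  have hgt : tsupport g ⊆ tsupport (Function.extend (Subtype.val : Ω → Eucl N) F 0) :=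
    closure_mono hgs
  refine ⟨⟨g, hg, hcs.mono hgs, hgt.trans hts⟩, fun x => ?_⟩
  have h1 := hgd x
  rw [Subtype.val_injective.extend_apply, Real.dist_eq, abs_sub_comm] at h1
  exact h1.le

theorem exists_hasCompactSupport_approx {X : Type*} [TopologicalSpace X] [T2Space X]
    (F : C₀(X, ℝ)) {ε : ℝ} (hε : 0 < ε) :
    ∃ G : X → ℝ, Continuous G ∧ HasCompactSupport G ∧ ∀ x, |F x - G x| ≤ ε := by
  -- The truncation of `F` at height `ε` is subtracted, which leaves zero where `|F| < ε`.
  refine ⟨fun x => F x - max (-ε) (min (F x) ε), ?_, ?_, fun x => ?_⟩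
  · have := F.continuous
    fun_prop
  · have h : ∀ᶠ x in cocompact X, |F x| < ε := by
      have := (zero_at_infty F).eventually (Metric.ball_mem_nhds (0 : ℝ) hε)
      simpa [Real.dist_eq] using this
    obtain ⟨K, hK, hKs⟩ := mem_cocompact.1 h
    refine HasCompactSupport.intro hK fun x hx => ?_
    have h1 : |F x| < ε := hKs hx
    rw [abs_lt] at h1
    rw [min_eq_left h1.2.le, max_eq_right h1.1.le, sub_self]
  · rw [sub_sub_cancel, abs_le]
    exact ⟨le_max_left _ _, max_le (by linarith) (min_le_right _ _)⟩

/-- Lebesgue measure on the subtype `Ω`. -/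
noncomputable abbrev volumeOn (Ω : Opens (Eucl N)) : Measure Ω :=
  (volume : Measure (Eucl N)).comap (Subtype.val : Ω → Eucl N)

theorem integrable_mul_of_continuous_of_hasCompactSupport {X : Type*} [TopologicalSpace X]
    [MeasurableSpace X] [OpensMeasurableSpace X] {μ : Measure X} {h F : X → ℝ}
    (hh : Integrable h μ) (hF : Continuous F) (hs : HasCompactSupport F) :
    Integrable (fun x => F x * h x) μ := by
  obtain ⟨C, hC⟩ := hF.bounded_above_of_compact_support hs
  exact hh.bdd_mul hF.aestronglyMeasurable (Eventually.of_forall hC)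

theorem integrable_testFunction_mul {h : Ω → ℝ} (hh : Integrable h (volumeOn Ω))
    (φ : TestFunction Ω ℝ (⊤ : ℕ∞)) : Integrable (fun x : Ω => φ x * h x) (volumeOn Ω) := by
  have hφ : Continuous (φ : Eucl N → ℝ) := (TestFunctionClass.map_contDiff φ).continuous
  obtain ⟨C, hC⟩ := hφ.bounded_above_of_compact_support
    (TestFunctionClass.map_hasCompactSupport φ)
  exact hh.bdd_mul (hφ.comp continuous_subtype_val).aestronglyMeasurable
    (Eventually.of_forall fun x => hC x)

theorem tendsto_integral_mul_of_hasCompactSupport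
    {h : ℕ → Ω → ℝ} {h₀ : Ω → ℝ} (hi : ∀ n, Integrable (h n) (volumeOn Ω))
    (hi₀ : Integrable h₀ (volumeOn Ω)) {M : ℝ} (hM : ∀ n, ∫ x, |h n x| ∂volumeOn Ω ≤ M)
    (ht : ∀ φ : TestFunction Ω ℝ (⊤ : ℕ∞), Tendsto (fun n => ∫ x, φ x * h n x ∂volumeOn Ω) atTop
      (𝓝 (∫ x, φ x * h₀ x ∂volumeOn Ω)))
    {F : Ω → ℝ} (hF : Continuous F) (hs : HasCompactSupport F) :
    Tendsto (fun n => ∫ x, F x * h n x ∂volumeOn Ω) atTop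
      (𝓝 (∫ x, F x * h₀ x ∂volumeOn Ω)) := by
  refine tendsto_integral_mul_of_uniform_approx hi hi₀ hM
    (fun n => integrable_mul_of_continuous_of_hasCompactSupport (hi n) hF hs)
    (integrable_mul_of_continuous_of_hasCompactSupport hi₀ hF hs) fun ε hε => ?_
  obtain ⟨φ, hφ⟩ := exists_testFunction_approx hF hs hε
  exact ⟨fun x => φ x, hφ, fun n => integrable_testFunction_mul (hi n) φ,
    integrable_testFunction_mul hi₀ φ, ht φ⟩

theorem tendsto_integral_mul_zeroAtInfty
    {h : ℕ → Ω → ℝ} {h₀ : Ω → ℝ} (hi : ∀ n, Integrable (h n) (volumeOn Ω))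
    (hi₀ : Integrable h₀ (volumeOn Ω)) {M : ℝ} (hM : ∀ n, ∫ x, |h n x| ∂volumeOn Ω ≤ M)
    (ht : ∀ φ : TestFunction Ω ℝ (⊤ : ℕ∞), Tendsto (fun n => ∫ x, φ x * h n x ∂volumeOn Ω) atTop
      (𝓝 (∫ x, φ x * h₀ x ∂volumeOn Ω)))
    (F : C₀(Ω, ℝ)) :
    Tendsto (fun n => ∫ x, F x * h n x ∂volumeOn Ω) atTop
      (𝓝 (∫ x, F x * h₀ x ∂volumeOn Ω)) := by
  have hb : ∀ {H : Ω → ℝ}, Integrable H (volumeOn Ω) →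
      Integrable (fun x => F x * H x) (volumeOn Ω) := fun hH =>
    hH.bdd_mul (c := ‖F.toBCF‖) F.continuous.aestronglyMeasurable
      (Eventually.of_forall fun x => F.toBCF.norm_coe_le_norm x)
  refine tendsto_integral_mul_of_uniform_approx hi hi₀ hM (fun n => hb (hi n)) (hb hi₀)
    fun ε hε => ?_
  obtain ⟨G, hG, hGs, hFG⟩ := exists_hasCompactSupport_approx F hε
  exact ⟨G, hFG, fun n => integrable_mul_of_continuous_of_hasCompactSupport (hi n) hG hGs,
    integrable_mul_of_continuous_of_hasCompactSupport hi₀ hG hGs,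
    tendsto_integral_mul_of_hasCompactSupport hi hi₀ hM ht hG hGs⟩

theorem tendsto_integral_mul_memLp {q' q : ℝ≥0∞} [ENNReal.HolderConjugate q' q]
    [IsFiniteMeasure (volumeOn Ω)] (hq : 1 ≤ q) (hq' : q' ≠ ⊤)
    {h : ℕ → Ω → ℝ} {h₀ : Ω → ℝ} (hi : ∀ n, MemLp (h n) q (volumeOn Ω))
    (hi₀ : MemLp h₀ q (volumeOn Ω)) {M : ℝ≥0∞} (hMtop : M ≠ ⊤)
    (hM : ∀ n, eLpNorm (h n) q (volumeOn Ω) ≤ M)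
    (ht : ∀ φ : TestFunction Ω ℝ (⊤ : ℕ∞), Tendsto (fun n => ∫ x, φ x * h n x ∂volumeOn Ω) atTop
      (𝓝 (∫ x, φ x * h₀ x ∂volumeOn Ω)))
    {F : Ω → ℝ} (hF : MemLp F q' (volumeOn Ω)) :
    Tendsto (fun n => ∫ x, F x * h n x ∂volumeOn Ω) atTop
      (𝓝 (∫ x, F x * h₀ x ∂volumeOn Ω)) := by
  refine tendsto_integral_mul_of_eLpNorm_approx hi hi₀ hMtop hM hF fun ε hε => ?_
  have : LocallyCompactSpace Ω := Ω.isOpen.locallyCompactSpace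
  obtain ⟨G, hGs, hFG, hG, hGm⟩ := hF.exists_hasCompactSupport_eLpNorm_sub_le hq' hε
  refine ⟨G, hGm, hFG, ?_⟩
  obtain ⟨c, hctop, hc⟩ := exists_eLpNorm_le_mul (volumeOn Ω) le_rfl hq
  refine tendsto_integral_mul_of_hasCompactSupport (fun n => (hi n).integrable hq)
    (hi₀.integrable hq) (M := (M * c).toReal) (fun n => ?_) ht hG hGs
  have h1 : ∫ x, |h n x| ∂volumeOn Ω = (eLpNorm (h n) 1 (volumeOn Ω)).toReal := by
    simp_rw [← Real.norm_eq_abs]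
    rw [integral_norm_eq_lintegral_enorm (hi n).1, eLpNorm_one_eq_lintegral_enorm]
  rw [h1]
  refine ENNReal.toReal_mono (ENNReal.mul_ne_top hMtop hctop) ?_
  exact (hc _ (hi n).1).trans (by rw [mul_comm]; gcongr; exact hM n)

/-! ### Weak convergence in normed spaces -/

theorem weakTendsto_iff {X : Type*} [NormedAddCommGroup X] [NormedSpace ℝ X] {u : ℕ → X} {v : X} :
    WeakTendsto u v ↔ ∀ l : X →L[ℝ] ℝ, Tendsto (fun n => l (u n)) atTop (𝓝 (l v)) := by
  have h : IsInducing fun (x : WeakSpace ℝ X) (l : StrongDual ℝ X) =>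
      (topDualPairing ℝ X).flip x l := ⟨rfl⟩
  unfold WeakTendsto
  rw [h.tendsto_nhds_iff, tendsto_pi_nhds]
  rfl

/-- The uniform boundedness principle in the dual, for the images of `u n` in the bidual. -/
theorem WeakTendsto.exists_norm_le {X : Type*} [NormedAddCommGroup X] [NormedSpace ℝ X]
    {u : ℕ → X} {v : X} (h : WeakTendsto u v) : ∃ C, ∀ n, ‖u n‖ ≤ C := by
  obtain ⟨C, hC⟩ := banach_steinhaus (g := fun n => NormedSpace.inclusionInDoubleDual ℝ X (u n))
    fun l => by
      obtain ⟨C, hC⟩ := (weakTendsto_iff.1 h l).norm.bddAbove_range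
      exact ⟨C, fun n => hC ⟨n, rfl⟩⟩
  refine ⟨C, fun n => ?_⟩
  rw [← (NormedSpace.inclusionInDoubleDualLi ℝ (E := X)).norm_map (u n)]
  exact hC n

/-! ### Measures with density and the subtype `Ω` -/

theorem integral_volumeOn (F : Eucl N → ℝ) :
    ∫ x : Ω, F x ∂volumeOn Ω = ∫ x, F x ∂lebesgueOn Ω :=
  integral_subtype_comap Ω.isOpen.measurableSet F

theorem map_volumeOn : (volumeOn Ω).map Subtype.val = lebesgueOn Ω :=
  map_comap_subtype_coe Ω.isOpen.measurableSet _

theorem eLpNorm_volumeOn (F : Eucl N → ℝ) (p : ℝ≥0∞) :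
    eLpNorm (fun x : Ω => F x) p (volumeOn Ω) = eLpNorm F p (lebesgueOn Ω) := by
  rw [← map_volumeOn]
  exact ((MeasurableEmbedding.subtype_coe Ω.isOpen.measurableSet).eLpNorm_map_measure
    (g := F)).symm

theorem memLp_volumeOn {F : Eucl N → ℝ} {p : ℝ≥0∞} (hF : MemLp F p (lebesgueOn Ω)) :
    MemLp (fun x : Ω => F x) p (volumeOn Ω) := by
  rw [← map_volumeOn] at hF
  exact (MeasurableEmbedding.subtype_coe Ω.isOpen.measurableSet).memLp_map_measure_iff.1 hF

/-- The integral against the signed measure `f dμ`, split into its positive and negative parts. -/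
theorem integral_withDensityᵥ {X : Type*} [MeasurableSpace X] {μ : Measure X} {f φ : X → ℝ}
    (hf : Integrable f μ) (hφ : AEStronglyMeasurable φ μ) {C : ℝ} (hC : ∀ x, ‖φ x‖ ≤ C) :
    ∫ᵛ x, φ x ∂<•(μ.withDensityᵥ f) = ∫ x, φ x * f x ∂μ := by
  have hfin := isFiniteMeasure_withDensity_ofReal hf.2
  have hfin' : IsFiniteMeasure (μ.withDensity fun x => ENNReal.ofReal (-f x)) :=
    isFiniteMeasure_withDensity_ofReal hf.neg.2
  have hi : ∀ g : X → ℝ, IsFiniteMeasure (μ.withDensity fun x => ENNReal.ofReal (g x)) →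
      Integrable φ (μ.withDensity fun x => ENNReal.ofReal (g x)) := fun g hg =>
    Integrable.of_bound (hφ.mono_ac (withDensity_absolutelyContinuous _ _)) C
      (Eventually.of_forall hC)
  rw [withDensityᵥ_eq_withDensity_pos_part_sub_withDensity_neg_part hf,
    VectorMeasure.integral_sub_vectorMeasure, VectorMeasure.integral_toSignedMeasure,
    VectorMeasure.integral_toSignedMeasure,
    integral_withDensity_eq_integral_toReal_smul₀ hf.1.aemeasurable.ennreal_ofReal
      (Eventually.of_forall fun _ => ENNReal.ofReal_lt_top),
    integral_withDensity_eq_integral_toReal_smul₀ (f := fun x => ENNReal.ofReal (-f x))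
      hf.1.aemeasurable.neg.ennreal_ofReal
      (Eventually.of_forall fun _ => ENNReal.ofReal_lt_top), ← integral_sub]
  · refine integral_congr_ae (Eventually.of_forall fun x => ?_)
    simp only [ENNReal.toReal_ofReal', smul_eq_mul]
    rw [← sub_mul, mul_comm (φ x)]
    congr 1
    rcases le_total 0 (f x) with h | h
    · rw [max_eq_left h, max_eq_right (by linarith), sub_zero]
    · rw [max_eq_right h, max_eq_left (by linarith)]; ring
  · refine (hf.pos_part.mul_bdd (c := C) hφ (Eventually.of_forall hC)).congr ?_
    exact Eventually.of_forall fun x => by simp [ENNReal.toReal_ofReal']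
  · refine (hf.neg_part.mul_bdd (c := C) hφ (Eventually.of_forall hC)).congr ?_
    exact Eventually.of_forall fun x => by simp [ENNReal.toReal_ofReal']
  · rw [VectorMeasure.Integrable, Measure.variation_toSignedMeasure]
    exact hi _ hfin
  · rw [VectorMeasure.Integrable, Measure.variation_toSignedMeasure]
    exact hi _ hfin'

/-! ### Minors of the Hessian along weakly convergent sequences -/

/-- Each component `π u` of `u`, such as `∂u/∂x_i`, converges weakly in `L^p(Ω)`, here tested with
continuous functions of compact support. -/
theorem tendsto_integral_mul_of_weakTendsto {p : ℝ≥0∞} [hp : Fact (1 ≤ p)]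
    {u : ℕ → SobolevW2 Ω p} {v : SobolevW2 Ω p} (h : WeakTendsto u v)
    (π : (LpOn Ω p × (Fin N → LpOn Ω p) × (Fin N → Fin N → LpOn Ω p)) →L[ℝ] LpOn Ω p)
    {ψ : Eucl N → ℝ} (hψ : Continuous ψ) (hs : HasCompactSupport ψ) :
    Tendsto (fun n => ∫ x, π (u n).1 x * ψ x ∂lebesgueOn Ω) atTop
      (𝓝 (∫ x, π v.1 x * ψ x ∂lebesgueOn Ω)) := by
  have hmem : MemLp ψ (ENNReal.conjExponent p) (lebesgueOn Ω) := hψ.memLp_of_hasCompactSupport hs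
  have : p.HolderConjugate (ENNReal.conjExponent p) := ENNReal.HolderConjugate.conjExponent hp.out
  have : (ENNReal.conjExponent p).HolderConjugate p := this.symm
  have : Fact (1 ≤ ENNReal.conjExponent p) := ⟨ENNReal.HolderConjugate.one_le _ p⟩
  have hl : ∀ f : LpOn Ω p, (ContinuousLinearMap.mul ℝ ℝ).lpPairing (lebesgueOn Ω)
      (ENNReal.conjExponent p) p (hmem.toLp ψ) f = ∫ x, f x * ψ x ∂lebesgueOn Ω := by
    intro f
    rw [ContinuousLinearMap.lpPairing_eq_integral]
    refine integral_congr_ae ?_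
    filter_upwards [hmem.coeFn_toLp] with x hx
    rw [hx, ContinuousLinearMap.mul_apply', mul_comm]
  have := weakTendsto_iff.1 h (((ContinuousLinearMap.mul ℝ ℝ).lpPairing (lebesgueOn Ω)
      (ENNReal.conjExponent p) p (hmem.toLp ψ)).comp (π.comp (SobolevW2 Ω p).subtypeL))
  simpa [hl] using this

theorem isW1_partialDeriv [IsFiniteMeasure (lebesgueOn Ω)] {p : ℝ≥0∞} [Fact (1 ≤ p)]
    {r : ℝ≥0∞} (hr : r ≤ p) (u : SobolevW2 Ω p) (i : Fin N) :
    IsW1 Ω r (u.1.2.1 i) (fun j => u.1.2.2 i j) where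
  measurable := (Lp.stronglyMeasurable _).measurable
  measurable_grad _ := (Lp.stronglyMeasurable _).measurable
  memLp := (Lp.memLp _).mono_exponent hr
  memLp_grad _ := (Lp.memLp _).mono_exponent hr
  weak j := u.2.2 i j

theorem exists_eLpNorm_le_of_weakTendsto {p : ℝ≥0∞} [hp : Fact (1 ≤ p)]
    {u : ℕ → SobolevW2 Ω p} {v : SobolevW2 Ω p} (h : WeakTendsto u v) :
    ∃ C : ℝ≥0∞, C ≠ ⊤ ∧ (∀ n i, eLpNorm ((u n).1.2.1 i) p (lebesgueOn Ω) ≤ C) ∧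
      ∀ n i j, eLpNorm ((u n).1.2.2 i j) p (lebesgueOn Ω) ≤ C := by
  obtain ⟨C, hC⟩ := h.exists_norm_le
  have key : ∀ f : LpOn Ω p, ‖f‖ ≤ C → eLpNorm f p (lebesgueOn Ω) ≤ ENNReal.ofReal C := by
    intro f hf
    rw [← ENNReal.ofReal_toReal (Lp.memLp f).2.ne, ← Lp.norm_def]
    exact ENNReal.ofReal_le_ofReal hf
  refine ⟨ENNReal.ofReal C, ENNReal.ofReal_ne_top, fun n i => key _ ?_, fun n i j => key _ ?_⟩
  · exact (norm_le_pi_norm (u n).1.2.1 i).trans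
      ((norm_fst_le (u n).1.2).trans ((norm_snd_le (u n).1).trans (hC n)))
  · exact (norm_le_pi_norm ((u n).1.2.2 i) j).trans ((norm_le_pi_norm (u n).1.2.2 i).trans
      ((norm_snd_le (u n).1.2).trans ((norm_snd_le (u n).1).trans (hC n))))

/-- The row `p ∈ P` of the minor consists of derivatives of `∂u/∂x_p`, so the minor is a Jacobian
determinant of first derivatives of `u`. -/
theorem tendsto_integral_mul_hessianMinor (hk : 1 ≤ k)
    (hΩ : Bornology.IsBounded (Ω : Set (Eucl N))) (P Q : Finset (Fin N))
    (hP : P.card = k) (hQ : Q.card = k) {p : ℝ≥0∞} [hp : Fact (1 ≤ p)] (hkp : (k : ℝ≥0∞) ≤ p)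
    {u : ℕ → SobolevW2 Ω p} {v : SobolevW2 Ω p} (h : WeakTendsto u v)
    (φ : TestFunction Ω ℝ (⊤ : ℕ∞)) :
    Tendsto (fun n => ∫ x : Ω, φ x * hessianMinor P Q hP hQ (u n) x ∂volumeOn Ω) atTop
      (𝓝 (∫ x : Ω, φ x * hessianMinor P Q hP hQ v x ∂volumeOn Ω)) := by
  have := isFiniteMeasure_lebesgueOn hΩ
  obtain ⟨C, hC, hb, hbg⟩ := exists_eLpNorm_le_of_weakTendsto h
  obtain ⟨c, hc, hcb⟩ := exists_eLpNorm_le_mul (lebesgueOn Ω) (Nat.one_le_cast.2 hk) hkp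
  have key := tendsto_integral_mul_det_gradMatrix hk (fun b => Q.orderEmbOfFin hQ b) hΩ
    (f := fun n a => (u n).1.2.1 (P.orderEmbOfFin hP a))
    (g := fun n a j => (u n).1.2.2 (P.orderEmbOfFin hP a) j)
    (f₀ := fun a => v.1.2.1 (P.orderEmbOfFin hP a))
    (g₀ := fun a j => v.1.2.2 (P.orderEmbOfFin hP a) j)
    (fun n a => isW1_partialDeriv hkp (u n) _) (fun a => isW1_partialDeriv hkp v _)
    (C := c * C) (ENNReal.mul_ne_top hc hC)
    (fun n a => (hcb _ (Lp.aestronglyMeasurable _)).trans (by gcongr; exact hb n _))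
    (fun n a i => (hcb _ (Lp.aestronglyMeasurable _)).trans (by gcongr; exact hbg n _ _))
    (fun a ψ hψ hs => tendsto_integral_mul_of_weakTendsto h
      ((ContinuousLinearMap.proj (P.orderEmbOfFin hP a)).comp
        ((ContinuousLinearMap.fst ℝ _ _).comp (ContinuousLinearMap.snd ℝ _ _))) hψ hs) φ
  simp_rw [fun w : SobolevW2 Ω p =>
    integral_volumeOn (Ω := Ω) fun x => φ x * hessianMinor P Q hP hQ w x]
  exact key

/-- The exponent of the Sobolev space is a variable `p = k * q`, so that `q = 1` applies to
`W^{2,k}(Ω)`. -/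
theorem memLp_hessianMinor (hk : 1 ≤ k) (P Q : Finset (Fin N)) (hP : P.card = k)
    (hQ : Q.card = k) {q p : ℝ≥0∞} [Fact (1 ≤ p)] (hq : 1 ≤ q) (hp : p = k * q)
    (u : SobolevW2 Ω p) : MemLp (hessianMinor P Q hP hQ u) q (lebesgueOn Ω) := by
  subst hp
  exact memLp_det hk hq fun a b => Lp.memLp (u.1.2.2 _ _)

theorem exists_eLpNorm_hessianMinor_le (hk : 1 ≤ k) (P Q : Finset (Fin N)) (hP : P.card = k)
    (hQ : Q.card = k) {q p : ℝ≥0∞} [Fact (1 ≤ p)] (hq : 1 ≤ q) (hp : p = k * q)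
    {u : ℕ → SobolevW2 Ω p} {v : SobolevW2 Ω p} (h : WeakTendsto u v) :
    ∃ M : ℝ≥0∞, M ≠ ⊤ ∧ ∀ n, eLpNorm (hessianMinor P Q hP hQ (u n)) q (lebesgueOn Ω) ≤ M := by
  subst hp
  obtain ⟨C, hC, -, hbg⟩ := exists_eLpNorm_le_of_weakTendsto h
  exact ⟨Fintype.card (Equiv.Perm (Fin k)) * C ^ k,
    ENNReal.mul_ne_top (ENNReal.natCast_ne_top _) (ENNReal.pow_ne_top hC), fun n =>
    eLpNorm_det_le_of_forall_le hk hq (fun a b => Lp.aestronglyMeasurable ((u n).1.2.2 _ _))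
      fun a b => hbg n _ _⟩

theorem weakStarTendsto_densityMeasure_hessianMinor (hk : 1 ≤ k)
    (hΩ : Bornology.IsBounded (Ω : Set (Eucl N))) (P Q : Finset (Fin N))
    (hP : P.card = k) (hQ : Q.card = k) [Fact ((1 : ℝ≥0∞) ≤ k)]
    {u : ℕ → SobolevW2 Ω k} {v : SobolevW2 Ω k} (h : WeakTendsto u v) :
    WeakStarTendsto (fun n => densityMeasure Ω (hessianMinor P Q hP hQ (u n)))
      (densityMeasure Ω (hessianMinor P Q hP hQ v)) := by
  intro φ
  have hi : ∀ w : SobolevW2 Ω k, Integrable (fun x : Ω => hessianMinor P Q hP hQ w x)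
      (volumeOn Ω) := fun w =>
    memLp_one_iff_integrable.1
      (memLp_volumeOn (memLp_hessianMinor hk P Q hP hQ le_rfl (mul_one _).symm w))
  have hint : ∀ w : SobolevW2 Ω k,
      ∫ᵛ x, φ x ∂<•(densityMeasure Ω (hessianMinor P Q hP hQ w)) =
        ∫ x : Ω, φ x * hessianMinor P Q hP hQ w x ∂volumeOn Ω := fun w =>
    integral_withDensityᵥ (hi w) φ.continuous.aestronglyMeasurable φ.toBCF.norm_coe_le_norm
  obtain ⟨M, hM, hMb⟩ := exists_eLpNorm_hessianMinor_le hk P Q hP hQ le_rfl (mul_one _).symm h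
  simp_rw [hint]
  refine tendsto_integral_mul_zeroAtInfty (fun n => hi (u n)) (hi v) (M := M.toReal) (fun n => ?_)
    (tendsto_integral_mul_hessianMinor hk hΩ P Q hP hQ le_rfl h) φ
  simp_rw [← Real.norm_eq_abs]
  rw [integral_norm_eq_lintegral_enorm (hi _).1, ← eLpNorm_one_eq_lintegral_enorm,
    eLpNorm_volumeOn]
  exact ENNReal.toReal_mono hM (hMb n)

theorem weakTendstoLp_hessianMinor (hk : 1 ≤ k)
    (hΩ : Bornology.IsBounded (Ω : Set (Eucl N))) (P Q : Finset (Fin N))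
    (hP : P.card = k) (hQ : Q.card = k) {q : ℝ≥0∞} (hq1 : 1 < q) (hq : q ≠ ⊤) [Fact (1 ≤ q)]
    [Fact ((1 : ℝ≥0∞) ≤ k * q)]
    {u : ℕ → SobolevW2 Ω (k * q)} {v : SobolevW2 Ω (k * q)} (h : WeakTendsto u v) :
    WeakTendstoLp Ω q (fun n => hessianMinor P Q hP hQ (u n)) (hessianMinor P Q hP hQ v) := by
  have hfin := isFiniteMeasure_lebesgueOn hΩ
  have hfin' : IsFiniteMeasure (volumeOn Ω) := by
    rw [← map_volumeOn] at hfin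
    exact Measure.isFiniteMeasure_of_map measurable_subtype_coe.aemeasurable
  have hmem := fun w => memLp_hessianMinor (Ω := Ω) hk P Q hP hQ hq1.le rfl w
  refine ⟨fun n => hmem (u n), hmem v, weakTendsto_iff.2 fun l => ?_⟩
  have hconj : q.HolderConjugate (ENNReal.conjExponent q) :=
    ENNReal.HolderConjugate.conjExponent hq1.le
  have hconj' : (ENNReal.conjExponent q).HolderConjugate q := hconj.symm
  have : Fact (1 ≤ ENNReal.conjExponent q) := ⟨ENNReal.HolderConjugate.one_le _ q⟩
  have hq' : ENNReal.conjExponent q ≠ ⊤ :=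
    (ENNReal.HolderConjugate.lt_top_iff_one_lt _ q).2 hq1 |>.ne
  -- The functional is integration against some `g` in the dual exponent, which is a limit of test
  -- functions.
  obtain ⟨g, hg, hgl⟩ := exists_memLp_forall_eq_integral (q' := ENNReal.conjExponent q) hq hq' l
  obtain ⟨M, hM, hMb⟩ := exists_eLpNorm_hessianMinor_le hk P Q hP hQ hq1.le rfl h
  have hl : ∀ w : SobolevW2 Ω (k * q), l ((hmem w).toLp (hessianMinor P Q hP hQ w)) =
      ∫ x : Ω, g x * hessianMinor P Q hP hQ w x ∂volumeOn Ω := by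
    intro w
    rw [hgl, integral_volumeOn fun x => g x * hessianMinor P Q hP hQ w x]
    refine integral_congr_ae ?_
    filter_upwards [(hmem w).coeFn_toLp] with x hx
    rw [hx]
  simp_rw [hl]
  refine tendsto_integral_mul_memLp hq1.le hq' (fun n => memLp_volumeOn (hmem (u n))) (memLp_volumeOn (hmem v))
    hM (fun n => (eLpNorm_volumeOn _ q).trans_le (hMb n)) ?_ (memLp_volumeOn hg)
  exact tendsto_integral_mul_hessianMinor hk hΩ P Q hP hQ (le_mul_of_one_le_right' hq1.le) h

end HessianMinors

theorem mainTheorem10 (N k : ℕ) (hk : 1 ≤ k) (hkN : k ≤ N)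
    (Ω : TopologicalSpace.Opens (HessianMinors.Eucl N))
    (hΩ : Bornology.IsBounded (Ω : Set (HessianMinors.Eucl N)))
    (P Q : Finset (Fin N)) (hP : P.card = k) (hQ : Q.card = k) :
    (haveI : Fact ((1 : ℝ≥0∞) ≤ (k : ℝ≥0∞)) := ⟨Nat.one_le_cast.2 hk⟩
      ∀ (u : ℕ → HessianMinors.SobolevW2 Ω (k : ℝ≥0∞))
        (v : HessianMinors.SobolevW2 Ω (k : ℝ≥0∞)),
        HessianMinors.WeakTendsto u v →
          (∀ n, Integrable (HessianMinors.hessianMinor P Q hP hQ (u n))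
            (HessianMinors.lebesgueOn Ω)) ∧
          Integrable (HessianMinors.hessianMinor P Q hP hQ v) (HessianMinors.lebesgueOn Ω) ∧
          HessianMinors.WeakStarTendsto
            (fun n => HessianMinors.densityMeasure Ω
              (HessianMinors.hessianMinor P Q hP hQ (u n)))
            (HessianMinors.densityMeasure Ω (HessianMinors.hessianMinor P Q hP hQ v))) ∧
    (∀ (q : ℝ≥0∞) (hq : 1 < q), q ≠ ⊤ →
      haveI : Fact ((1 : ℝ≥0∞) ≤ q) := ⟨hq.le⟩
      haveI : Fact ((1 : ℝ≥0∞) ≤ (k : ℝ≥0∞) * q) :=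
        ⟨one_le_mul (Nat.one_le_cast.2 hk) hq.le⟩
      ∀ (u : ℕ → HessianMinors.SobolevW2 Ω ((k : ℝ≥0∞) * q))
        (v : HessianMinors.SobolevW2 Ω ((k : ℝ≥0∞) * q)),
        HessianMinors.WeakTendsto u v →
          HessianMinors.WeakTendstoLp Ω q
            (fun n => HessianMinors.hessianMinor P Q hP hQ (u n))
            (HessianMinors.hessianMinor P Q hP hQ v)) := by
  have : Fact ((1 : ℝ≥0∞) ≤ (k : ℝ≥0∞)) := ⟨Nat.one_le_cast.2 hk⟩
  refine ⟨fun u v h => ?_, fun q hq hqt u v h => ?_⟩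
  · have hi := fun w : HessianMinors.SobolevW2 Ω (k : ℝ≥0∞) => memLp_one_iff_integrable.1
      (HessianMinors.memLp_hessianMinor hk P Q hP hQ le_rfl (mul_one _).symm w)
    exact ⟨fun n => hi (u n), hi v,
      HessianMinors.weakStarTendsto_densityMeasure_hessianMinor hk hΩ P Q hP hQ h⟩
  · have : Fact ((1 : ℝ≥0∞) ≤ q) := ⟨hq.le⟩
    have : Fact ((1 : ℝ≥0∞) ≤ (k : ℝ≥0∞) * q) := ⟨one_le_mul (Nat.one_le_cast.2 hk) hq.le⟩
    exact HessianMinors.weakTendstoLp_hessianMinor hk hΩ P Q hP hQ hq hqt h
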